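/- Let $X,Y$ be compact Hausdorff second countable spaces and let $p:Y\to X$ be a branched covering, i.e. an open and closed continuous surjection such that $\#p^{-1}(x)$ is uniformly bounded over $x\in X$. Regard $C(X)$ as a subalgebra of $C(Y)$ via $i(a)=a\circ p$. Let $\mu:Y\to[0,1]$ be a weight function for $p$: $\mu\ge c$ on $Y$ for some constant $c>0$, $\sum_{p(y)=x}\mu(y)=1$ for every $x\in X$, and for every $f\in C(Y)$ the function $$E_\mu(f)(x)=\sum_{p(y)=x}f(y)\,\mu(y)$$ is continuous on $X$. Then $E_\mu:C(Y)\to C(X)$ is a unital positive conditional expectation that is topologically of index-finite type, i.e. $K\cdot (i\circ E_\mu)-\mathrm{id}$ is positive for some real $K\ge 1$. The enveloping von Neumann algebra $C(Y)^{**}$ is the second dual with its canonical (Arens) product and involution and with the ultraweak topology $\sigma(C(Y)^{**},C(Y)^{*})$. The bidual maps $E_\mu^{**}$ and $i^{**}$ make it a module over $C(X)^{**}$ with inner product $\langle a,b\rangle=E_\mu^{**}(a^*b)$. A quasi-orthonormal basis is a set $S\subset C(Y)^{**}$ with $\langle a,b\rangle=0$ for distinct $a,b\in S$, with $\langle a,a\rangle$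 a projection for $a\in S$, and with $b=\sum_{a\in S}a\, i^{**}(\langle a,b\rangle)$ ultraweakly for all $b\in C(Y)^{**}$. The Frank--Kirchberg index element $\mathrm{Index}(E_\mu)\in C(Y)^{**}$ is the ultraweak sum $\sum_{a\in S}a^*a$ for any quasi-orthonormal basis $S$. Let $X_j=\{x\in X:\#p^{-1}(x)=j\}$. A regular neighbourhood of a point $x\in X_j$ with $p^{-1}(x)=\{y_1,\dots,y_j\}$ is an open $U\ni x$ together with pairwise disjoint open sets $V_t\ni y_t$ such that $p^{-1}(U)=V_1\sqcup\dots\sqcup V_j$. A regular decomposition consists of countable partitions $X_j=\bigsqcup_{s}X_j^s$ (empty sets allowed) such that $X_j^s$ is open in $\bigsqcup_{r\ge s}X_j^r$ and, if non-empty, is contained in a regular neighbourhood $U$ of a point of $X_j$, together with the sets $Y_j^{s,t}=V_t\cap p^{-1}(X_j^s)$, $1\le t\le j$ (empty if $X_j^s$ is), each of which is required to meet every fibre over $X_j^s$. Put $m_{jst}=1/\sqrt{\mu}$ on $Y_j^{s,t}$ and $m_{jst}=0$ elsewhere, and let $M=\sum_{j,s,t}m_{jst}^*m_{jst}$. Regular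 decompositions exist. For each of them, $M$ is a bounded Borel function on $Y$ that equals $1/\mu$ and is continuous on each $Y_j^{s,t}$. It defines a unique element of $C(Y)^{**}$, the one whose value on every finite positive Borel measure $\nu$ on $Y$ is $\int_Y M\,d\nu$. Moreover $\mathrm{Index}(E_\mu)$ exists (quasi-orthonormal bases exist, and $\sum a^*a$ does not depend on the basis), and $$M=\mathrm{Index}(E_\mu)\quad\text{in } C(Y)^{**}.$$ -/

import Mathlib

open MeasureTheory

noncomputable section

/-! ### The enveloping von Neumann algebra of a C*-algebra

The enveloping von Neumann algebra of `B` is the second dual `B**` with the (Arens) product and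
the involution that extend those of `B`; its ultraweak topology is the topology of pointwise
convergence on `B*`. -/

section Bidual

variable {B : Type*} [CStarAlgebra B]

/-- The second dual `B**`. -/
abbrev Bidual (B : Type*) [CStarAlgebra B] : Type _ := StrongDual ℂ (StrongDual ℂ B)

/-- The map `φ ↦ F · φ` of `B*`, where `(F · φ)(b) = F (φ · b)` and `(φ · b)(c) = φ (b * c)`. -/
def Bidual.act (F : Bidual B) : StrongDual ℂ B →L[ℂ] StrongDual ℂ B :=
  (ContinuousLinearMap.compL ℂ B (StrongDual ℂ B) ℂ F) ∘L
    ((ContinuousLinearMap.compL ℂ B (B →L[ℂ] B) (StrongDual ℂ B)).flip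
      (ContinuousLinearMap.mul ℂ B)) ∘L
    (ContinuousLinearMap.compL ℂ B B ℂ)

theorem Bidual.act_apply (F : Bidual B) (φ : StrongDual ℂ B) (b : B) :
    F.act φ b = F (φ ∘L ContinuousLinearMap.mul ℂ B b) := rfl

/-- The product of `B**`: `(G F)(φ) = G (F · φ)`. -/
def Bidual.mul (G F : Bidual B) : Bidual B := G ∘L F.act

theorem norm_conj_dual_apply_le (φ : StrongDual ℂ B) (b : B) :
    ‖starRingEnd ℂ (φ (star b))‖ ≤ ‖φ‖ * ‖b‖ := by
  rw [RCLike.norm_conj]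
  exact (φ.le_opNorm _).trans_eq (by rw [norm_star])

/-- The involution of `B*`: `φ*(b) = conj (φ (b*))`. -/
def dualStar (φ : StrongDual ℂ B) : StrongDual ℂ B :=
  LinearMap.mkContinuous
    { toFun := fun b => starRingEnd ℂ (φ (star b))
      map_add' := fun a b => by simp
      map_smul' := fun c b => by simp } ‖φ‖ (norm_conj_dual_apply_le φ)

theorem dualStar_apply (φ : StrongDual ℂ B) (b : B) :
    dualStar φ b = starRingEnd ℂ (φ (star b)) := rfl

theorem norm_dualStar_le (φ : StrongDual ℂ B) : ‖dualStar φ‖ ≤ ‖φ‖ :=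
  LinearMap.mkContinuous_norm_le _ (norm_nonneg _) _

/-- The involution of `B**`: `F*(φ) = conj (F (φ*))`. -/
def Bidual.conj (F : Bidual B) : Bidual B :=
  LinearMap.mkContinuous
    { toFun := fun φ => starRingEnd ℂ (F (dualStar φ))
      map_add' := fun φ ψ => by
        have h : dualStar (φ + ψ) = dualStar φ + dualStar ψ := by
          ext b; simp [dualStar_apply]
        simp [h]
      map_smul' := fun c φ => by
        have h : dualStar (c • φ) = starRingEnd ℂ c • dualStar φ := by
          ext b; simp [dualStar_apply]
        simp [h] } ‖F‖ (fun φ => by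
          change ‖starRingEnd ℂ (F (dualStar φ))‖ ≤ ‖F‖ * ‖φ‖
          rw [RCLike.norm_conj]
          exact (F.le_opNorm _).trans
            (mul_le_mul_of_nonneg_left (norm_dualStar_le φ) (norm_nonneg _)))

theorem Bidual.conj_apply (F : Bidual B) (φ : StrongDual ℂ B) :
    F.conj φ = starRingEnd ℂ (F (dualStar φ)) := rfl

/-- The biadjoint `T** : A** → B**` of a bounded operator `T : A → B`. -/
def biadjoint {A : Type*} [CStarAlgebra A] (T : A →L[ℂ] B) : Bidual A →L[ℂ] Bidual B :=
  (ContinuousLinearMap.compL ℂ (StrongDual ℂ B) (StrongDual ℂ A) ℂ).flip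
    ((ContinuousLinearMap.compL ℂ A B ℂ).flip T)

theorem biadjoint_apply {A : Type*} [CStarAlgebra A] (T : A →L[ℂ] B) (F : Bidual A)
    (φ : StrongDual ℂ B) : biadjoint T F φ = F (φ ∘L T) := rfl

end Bidual

/-! ### Conditional expectations and their index -/

section Expectation

variable {A B : Type*} [CommCStarAlgebra A] [CommCStarAlgebra B]

/-- A unital *-homomorphism of C*-algebras as a bounded linear map. -/
def starHomCLM (i : A →⋆ₐ[ℂ] B) : A →L[ℂ] B :=
  LinearMap.mkContinuous i.toAlgHom.toLinearMap 1
    (fun a => by rw [one_mul]; exact NonUnitalStarAlgHom.norm_apply_le i a)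

/-- `E : B → A` is a (unital, positive) conditional expectation for the inclusion `i : A → B`. -/
structure IsConditionalExpectation (i : A →⋆ₐ[ℂ] B) (E : B →L[ℂ] A) : Prop where
  injective : Function.Injective i
  norm_le : ∀ b, ‖E b‖ ≤ ‖b‖
  retract : ∀ a, E (i a) = a
  left_mul : ∀ a b, E (i a * b) = a * E b
  right_mul : ∀ a b, E (b * i a) = E b * a
  positive : ∀ b, ∃ c, E (star b * b) = star c * c

/-- `E` is topologically of index-finite type: `K · E - id` is positive for some `K ≥ 1`. -/
def IsTopologicallyIndexFinite (i : A →⋆ₐ[ℂ] B) (E : B →L[ℂ] A) : Prop :=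
  ∃ K : ℝ, 1 ≤ K ∧ ∀ b, ∃ c, (K : ℂ) • i (E (star b * b)) - star b * b = star c * c

/-- The inner product `⟨x, y⟩ = E**(x* y)` on `B**` with values in `A**`. -/
def bidualInner (E : B →L[ℂ] A) (x y : Bidual B) : Bidual A :=
  biadjoint E (x.conj.mul y)

/-- A quasi-orthonormal basis of the Hilbert module `B**` over `A**` with inner product
`E**(x* y)`: an orthogonal system whose inner squares are projections, in which every `b` has
the ultraweakly convergent expansion `b = ∑ x ⟨x, b⟩`. -/
structure IsQuasiOrthonormalBasis (i : A →⋆ₐ[ℂ] B) (E : B →L[ℂ] A) (S : Set (Bidual B)) :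
    Prop where
  orthogonal : ∀ x ∈ S, ∀ y ∈ S, x ≠ y → bidualInner E x y = 0
  idempotent : ∀ x ∈ S, (bidualInner E x x).mul (bidualInner E x x) = bidualInner E x x
  selfAdjoint : ∀ x ∈ S, (bidualInner E x x).conj = bidualInner E x x
  expansion : ∀ (b : Bidual B) (φ : StrongDual ℂ B),
    HasSum (fun x : S => (x : Bidual B).mul (biadjoint (starHomCLM i) (bidualInner E x b)) φ)
      (b φ)

/-- `J ∈ B**` is the index element of `E`: quasi-orthonormal bases exist, and for every one of
them `J` is the ultraweak sum `∑ x* x`. -/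
def IsIndexElement (i : A →⋆ₐ[ℂ] B) (E : B →L[ℂ] A) (J : Bidual B) : Prop :=
  (∃ S, IsQuasiOrthonormalBasis i E S) ∧
  ∀ S, IsQuasiOrthonormalBasis i E S → ∀ φ : StrongDual ℂ B,
    HasSum (fun x : S => (x : Bidual B).conj.mul x φ) (J φ)

end Expectation

/-! ### Branched coverings, weights and regular decompositions -/

section Covering

variable {X Y : Type*} [TopologicalSpace X] [TopologicalSpace Y]

/-- A branched covering (of compact Hausdorff spaces): an open and closed continuous surjection
with a uniformly bounded number of pre-images. -/
structure IsBranchedCovering (p : C(Y, X)) : Prop where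
  surjective : Function.Surjective p
  isClosedMap : IsClosedMap p
  isOpenMap : IsOpenMap p
  bounded : ∃ N : ℕ, ∀ x, (p ⁻¹' {x}).encard ≤ N

theorem IsBranchedCovering.finite {p : C(Y, X)} (hp : IsBranchedCovering p) (x : X) :
    (p ⁻¹' {x}).Finite := by
  obtain ⟨N, hN⟩ := hp.bounded
  exact Set.finite_of_encard_le_coe (hN x)

/-- A weight function `μ : Y → [0, 1]`, bounded away from `0`, with sum `1` on each fibre, for
which the functions `x ↦ ∑_{p(y) = x} f(y) μ(y)`, `f ∈ C(Y)`, are continuous. -/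
structure WeightFunction (p : C(Y, X)) where
  μ : Y → ℝ
  mem_Icc : ∀ y, μ y ∈ Set.Icc (0 : ℝ) 1
  bounded_below : ∃ c : ℝ, 0 < c ∧ ∀ y, c ≤ μ y
  sum_eq_one : ∀ x, ∑ᶠ y ∈ p ⁻¹' {x}, μ y = 1
  continuous_sum : ∀ f : C(Y, ℂ), Continuous fun x => ∑ᶠ y ∈ p ⁻¹' {x}, f y * (μ y : ℂ)

/-- The `j`-th stratum: the points with exactly `j` pre-images. -/
def stratum (p : C(Y, X)) (j : ℕ) : Set X := {x | (p ⁻¹' {x}).encard = j}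

/-- `U` is a regular neighbourhood of `x`, where `x` has exactly `j` pre-images `y_1, …, y_j`:
`p⁻¹(U) = V_1 ⊔ … ⊔ V_j` with open neighbourhoods `V_t` of `y_t`. -/
structure IsRegularNhd (p : C(Y, X)) (x : X) {j : ℕ} (U : Set X) (V : Fin j → Set Y) :
    Prop where
  isOpen_U : IsOpen U
  mem_U : x ∈ U
  isOpen_V : ∀ t, IsOpen (V t)
  disjoint : Pairwise fun s t => Disjoint (V s) (V t)
  preimage_eq : p ⁻¹' U = ⋃ t, V t
  centers : ∃ y : Fin j → Y, Function.Injective y ∧ Set.range y = p ⁻¹' {x} ∧ ∀ t, y t ∈ V t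

/-- A countable partition of each stratum `X_j` into sets `X_j^s`, with `X_j^s` open in
`X_j^s ⊔ X_j^{s+1} ⊔ …` and contained in a regular neighbourhood of a point of `X_j`, together
with the induced decompositions `p⁻¹(X_j^s) = Y_j^{s,1} ⊔ … ⊔ Y_j^{s,j}`, each piece of which
meets all the fibres over `X_j^s`. -/
structure RegularDecomposition (p : C(Y, X)) where
  base : ℕ → ℕ → Set X
  piece : (j : ℕ) → ℕ → Fin j → Set Y
  iUnion_base : ∀ j, ⋃ s, base j s = stratum p j
  disjoint_base : ∀ j, Pairwise fun r s => Disjoint (base j r) (base j s)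
  open_in_tail : ∀ j s, ∃ O : Set X, IsOpen O ∧ base j s = O ∩ ⋃ r ≥ s, base j r
  piece_subset : ∀ j s t, piece j s t ⊆ p ⁻¹' base j s
  regular : ∀ j s, (base j s).Nonempty → ∃ x ∈ stratum p j, ∃ (U : Set X) (V : Fin j → Set Y),
    IsRegularNhd p x U V ∧ base j s ⊆ U ∧ ∀ t, piece j s t = V t ∩ p ⁻¹' base j s
  base_subset_image : ∀ j s t, base j s ⊆ p '' piece j s t

/-- The functions `m_{jst}`: `1 / √μ` on `Y_j^{s,t}` and `0` elsewhere. -/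
def RegularDecomposition.m {p : C(Y, X)} (D : RegularDecomposition p) (w : WeightFunction p)
    (a : Σ j : ℕ, ℕ × Fin j) : Y → ℂ :=
  (D.piece a.1 a.2.1 a.2.2).indicator fun y => ((1 / √(w.μ y) : ℝ) : ℂ)

/-- The function `M = ∑ m_{jst}* m_{jst}`. -/
def RegularDecomposition.M {p : C(Y, X)} (D : RegularDecomposition p) (w : WeightFunction p)
    (y : Y) : ℂ :=
  ∑' a : (Σ j : ℕ, ℕ × Fin j), star (D.m w a y) * D.m w a y

variable [CompactSpace X] [CompactSpace Y]

/-- The expectation `E_μ : C(Y) → C(X)`, `E_μ(f)(x) = ∑_{p(y) = x} f(y) μ(y)`. -/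
def weightedExpectation {p : C(Y, X)} (hp : IsBranchedCovering p) (w : WeightFunction p) :
    C(Y, ℂ) →L[ℂ] C(X, ℂ) :=
  LinearMap.mkContinuous
    { toFun := fun f => ⟨fun x => ∑ᶠ y ∈ p ⁻¹' {x}, f y * (w.μ y : ℂ), w.continuous_sum f⟩
      map_add' := fun f g => by
        ext x
        simp only [ContinuousMap.coe_mk, ContinuousMap.add_apply, add_mul]
        exact finsum_mem_add_distrib (hp.finite x)
      map_smul' := fun c f => by
        ext x
        simp only [ContinuousMap.coe_mk, ContinuousMap.smul_apply, smul_eq_mul, mul_assoc,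
          RingHom.id_apply]
        exact (mul_finsum_mem _ _).symm } 1
    (fun f => by
      rw [one_mul, ContinuousMap.norm_le _ (norm_nonneg f)]
      intro x
      change ‖∑ᶠ y ∈ p ⁻¹' {x}, f y * (w.μ y : ℂ)‖ ≤ ‖f‖
      have h1 := w.sum_eq_one x
      rw [finsum_mem_eq_finite_toFinset_sum _ (hp.finite x)] at h1 ⊢
      refine (norm_sum_le _ _).trans ?_
      calc ∑ y ∈ (hp.finite x).toFinset, ‖f y * (w.μ y : ℂ)‖
          ≤ ∑ y ∈ (hp.finite x).toFinset, ‖f‖ * w.μ y := by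
            refine Finset.sum_le_sum fun y _ => ?_
            rw [norm_mul, Complex.norm_real, Real.norm_of_nonneg (w.mem_Icc y).1]
            exact mul_le_mul_of_nonneg_right (f.norm_coe_le_norm y) (w.mem_Icc y).1
        _ = ‖f‖ := by rw [← Finset.mul_sum, h1, mul_one])

theorem weightedExpectation_apply {p : C(Y, X)} (hp : IsBranchedCovering p)
    (w : WeightFunction p) (f : C(Y, ℂ)) (x : X) :
    weightedExpectation hp w f x = ∑ᶠ y ∈ p ⁻¹' {x}, f y * (w.μ y : ℂ) := rfl

/-! ### Bounded Borel functions as elements of `C(Y)**` -/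

variable [MeasurableSpace Y] [BorelSpace Y]

/-- The functional `f ↦ ∫ f dν` on `C(Y)` given by a finite positive Borel measure `ν`. -/
def integralFunctional (ν : Measure Y) [IsFiniteMeasure ν] : StrongDual ℂ C(Y, ℂ) :=
  LinearMap.mkContinuous
    { toFun := fun f => ∫ y, f y ∂ν
      map_add' := fun f g => integral_add
        (f.continuous.integrable_of_hasCompactSupport (HasCompactSupport.of_compactSpace f))
        (g.continuous.integrable_of_hasCompactSupport (HasCompactSupport.of_compactSpace g))
      map_smul' := fun c f => integral_const_mul c _ } (ν.real Set.univ)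
    (fun f => by
      rw [mul_comm]
      exact norm_integral_le_of_norm_le_const (Filter.Eventually.of_forall f.norm_coe_le_norm))

/-- `F ∈ C(Y)**` is the element given by the bounded Borel function `g`: its value on each
finite positive Borel measure `ν` is `∫ g dν`. (These measures span `C(Y)*`.) -/
def IsBorelElement (g : Y → ℂ) (F : Bidual C(Y, ℂ)) : Prop :=
  Measurable g ∧ (∃ C : ℝ, ∀ y, ‖g y‖ ≤ C) ∧
    ∀ (ν : Measure Y) [IsFiniteMeasure ν], F (integralFunctional ν) = ∫ y, g y ∂ν

end Covering

end

/-! Everything in `C(Y)**` is tested on positive measures. By Riesz–Markov and the Jordan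
decomposition the functionals `∫ · dν` span the dual (`span_integralFunctional`), so they separate
elements of the bidual, and a bounded nonnegative Borel function `r` defines an element
`borelElement r`. This element acts on measures by `ν ↦ rν`, hence Borel elements multiply pointwise
(`borelElement_mul`). For a fixed `ν`, an arbitrary element of the bidual is represented by a vector
of `L²(ν)` (`Bidual.exists_density`). This gives commutativity of the product and positivity of `x*
x`.

On measures, the adjoint of `i` is push-forward along `p`, and the adjoint of `E_μ` replaces a point
by the measure `∑ μ(y) δ_y` on its fibre. A piece `P` of a regular decomposition meets each fibre at
most once, by counting (`injOn_piece`). Between functions supported in `P` the expectation is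
therefore multiplication by `μ`: `i**(E**(x h)) g = x (g μ h)` (`biadjoint_mul_borelElement`). Both
halves of the index statement follow from this formula.

Existence: the functions `1/√μ` on the nonempty pieces form a quasi-orthonormal basis. With `a` such
a function, `a ⟨a, c⟩` is the restriction of `c` to the piece, and the pieces are a countable Borel
partition of `Y`.

Independence: for any basis `S`, expand `1_P` and multiply by `1_P/μ`. The formula turns this into
`1_P/μ = ∑ x x* 1_P`, so `∑ x* x` agrees with `1/μ` on every piece. All terms are nonnegative on
positive measures, so the sums over `S` and over the pieces may be exchanged
(`hasSum_conj_mul_self`). Finally `M = 1/μ` pointwise, because each point lies in exactly one piece.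
-/

/-! ### Positive functionals span the dual of `C(Z)` -/

section Jordan

open scoped NNReal ENNReal CompactlySupported

variable {Z : Type*} [TopologicalSpace Z]

/-- Riesz decomposition in the cone of nonnegative continuous functions. -/
theorem ContinuousMap.exists_add_eq_of_le_add {f₁ f₂ g : C(Z, ℝ≥0)} (h : g ≤ f₁ + f₂) :
    ∃ g₁ g₂ : C(Z, ℝ≥0), g₁ ≤ f₁ ∧ g₂ ≤ f₂ ∧ g₁ + g₂ = g := by
  -- As much of `g` as fits under `f₁` goes into the first summand; the truncated remainder fits
  -- under `f₂`.
  refine ⟨g ⊓ f₁, g - g ⊓ f₁, inf_le_right, fun z => ?_, ?_⟩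
  · have hz : g z ≤ f₁ z + f₂ z := h z
    change g z - min (g z) (f₁ z) ≤ f₂ z
    rcases le_total (g z) (f₁ z) with h' | h'
    · simp [h']
    · rw [min_eq_right h']
      exact tsub_le_iff_left.mpr hz
  · ext z
    simp only [ContinuousMap.add_apply, ContinuousMap.sub_apply, ContinuousMap.inf_apply]
    rw [add_tsub_cancel_of_le (min_le_left _ _)]

/-- An order bounded linear functional on nonnegative continuous functions is dominated by a
positive one. -/
theorem exists_linearMap_majorant (φ : C(Z, ℝ≥0) →ₗ[ℝ≥0] ℝ)
    (hφ : ∀ f, BddAbove (φ '' Set.Iic f)) :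
    ∃ Λ : C(Z, ℝ≥0) →ₗ[ℝ≥0] ℝ≥0, ∀ f, φ f ≤ Λ f := by
  have hzero (f : C(Z, ℝ≥0)) : (0 : C(Z, ℝ≥0)) ≤ f := fun z => zero_le
  -- The positive part of `φ`: its supremum over the order interval `[0, f]`. Riesz decomposition
  -- makes it additive.
  let q : C(Z, ℝ≥0) → ℝ := fun f => sSup (φ '' Set.Iic f)
  have hq {f g : C(Z, ℝ≥0)} (h : g ≤ f) : φ g ≤ q f := le_csSup (hφ f) ⟨g, h, rfl⟩
  have hne (f : C(Z, ℝ≥0)) : (φ '' Set.Iic f).Nonempty := ⟨φ 0, 0, hzero f, rfl⟩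
  have hq0 (f : C(Z, ℝ≥0)) : 0 ≤ q f := by simpa using hq (hzero f)
  have hadd (f₁ f₂ : C(Z, ℝ≥0)) : q (f₁ + f₂) = q f₁ + q f₂ := by
    refine le_antisymm (csSup_le (hne _) ?_) ?_
    · rintro _ ⟨g, hg, rfl⟩
      obtain ⟨g₁, g₂, h₁, h₂, rfl⟩ := ContinuousMap.exists_add_eq_of_le_add hg
      rw [map_add]
      exact add_le_add (hq h₁) (hq h₂)
    · rw [← le_sub_iff_add_le]
      refine csSup_le (hne _) ?_
      rintro _ ⟨g₁, h₁, rfl⟩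
      rw [le_sub_comm]
      refine csSup_le (hne _) ?_
      rintro _ ⟨g₂, h₂, rfl⟩
      rw [le_sub_iff_add_le, add_comm, ← map_add]
      exact hq (add_le_add h₁ h₂)
  have hle (c : ℝ≥0) (f : C(Z, ℝ≥0)) : c * q f ≤ q (c • f) := by
    rcases eq_or_ne c 0 with rfl | hc
    · simpa using hq0 _
    · rw [← le_div_iff₀' (by positivity)]
      refine csSup_le (hne _) ?_
      rintro _ ⟨g, hg, rfl⟩
      rw [le_div_iff₀' (by positivity)]
      have : φ (c • g) = c * φ g := by rw [map_smul]; rfl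
      rw [← this]
      exact hq fun z => mul_le_mul_right (hg z) c
  have hsmul (c : ℝ≥0) (f : C(Z, ℝ≥0)) : q (c • f) = c * q f := by
    rcases eq_or_ne c 0 with rfl | hc
    · have := hadd 0 0
      simp only [add_zero, left_eq_add] at this
      simp [this]
    · refine le_antisymm ?_ (hle c f)
      have := hle c⁻¹ (c • f)
      rw [smul_smul, inv_mul_cancel₀ hc, one_smul, NNReal.coe_inv] at this
      rwa [inv_mul_le_iff₀ (by positivity)] at this
  refine ⟨{ toFun := fun f => ⟨q f, hq0 f⟩
            map_add' := fun f g => NNReal.eq (hadd f g)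
            map_smul' := fun c f => NNReal.eq (hsmul c f) }, fun f => hq le_rfl⟩

variable [CompactSpace Z] [MeasurableSpace Z] [BorelSpace Z]

theorem integralFunctional_apply (ν : Measure Z) [IsFiniteMeasure ν] (f : C(Z, ℂ)) :
    integralFunctional ν f = ∫ z, f z ∂ν := rfl

theorem ContinuousMap.integrable_of_isFiniteMeasure {E : Type*} [NormedAddCommGroup E]
    (f : C(Z, E)) (ν : Measure Z) [IsFiniteMeasure ν] : Integrable (fun z => f z) ν :=
  f.continuous.integrable_of_hasCompactSupport (HasCompactSupport.of_compactSpace f)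

variable [T2Space Z]

/-- The Riesz–Markov–Kakutani theorem on a compact space. -/
theorem exists_measure_of_linearMap (Λ : C(Z, ℝ≥0) →ₗ[ℝ≥0] ℝ≥0) :
    ∃ ν : Measure Z, IsFiniteMeasure ν ∧ ∀ f : C(Z, ℝ≥0), ∫ z, (f z : ℝ) ∂ν = Λ f := by
  let T : C_c(Z, ℝ≥0) →ₗ[ℝ≥0] ℝ≥0 :=
    { toFun := fun f => Λ f.toContinuousMap
      map_add' := fun f g => map_add Λ f.toContinuousMap g.toContinuousMap
      map_smul' := fun c f => map_smul Λ c f.toContinuousMap }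
  let e : C(Z, ℝ≥0) → C_c(Z, ℝ≥0) := CompactlySupportedContinuousMap.continuousMapEquiv
  refine ⟨NNRealRMK.rieszMeasure T, ⟨?_⟩, fun f => NNRealRMK.integral_rieszMeasure T (e f)⟩
  have := NNRealRMK.lintegral_rieszMeasure T (e 1)
  have h1 : ∀ z, (e 1 z : ℝ≥0∞) = 1 := fun z => rfl
  simp only [h1, lintegral_one] at this
  rw [this]
  exact ENNReal.coe_lt_top

/-- The Jordan decomposition of a bounded functional on real continuous functions. -/
theorem exists_measure_sub (φ : C(Z, ℝ) →L[ℝ] ℝ) :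
    ∃ ν₁ ν₂ : Measure Z, IsFiniteMeasure ν₁ ∧ IsFiniteMeasure ν₂ ∧
      ∀ f : C(Z, ℝ), φ f = ∫ z, f z ∂ν₁ - ∫ z, f z ∂ν₂ := by
  let ι : C(Z, ℝ≥0) → C(Z, ℝ) := fun f => ⟨fun z => (f z : ℝ), by fun_prop⟩
  let ψ : C(Z, ℝ≥0) →ₗ[ℝ≥0] ℝ :=
    { toFun := fun f => φ (ι f)
      map_add' := fun f g => by
        rw [← map_add]; congr 1
      map_smul' := fun c f => by
        have : ι (c • f) = (c : ℝ) • ι f := by ext z; simp [ι]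
        rw [this, map_smul]; rfl }
  obtain ⟨Λ, hΛ⟩ := exists_linearMap_majorant ψ (fun f => by
    refine ⟨‖φ‖ * ‖ι f‖, ?_⟩
    rintro _ ⟨g, hg, rfl⟩
    refine (le_abs_self _).trans ((φ.le_opNorm _).trans ?_)
    refine mul_le_mul_of_nonneg_left ?_ (norm_nonneg _)
    rw [ContinuousMap.norm_le _ (norm_nonneg _)]
    intro z
    refine le_trans ?_ ((ι f).norm_coe_le_norm z)
    have : (g z : ℝ) ≤ f z := hg z
    simpa [ι] using this)
  -- `φ = Λ - (Λ - φ)` is a difference of two positive functionals.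
  let Λ₂ : C(Z, ℝ≥0) →ₗ[ℝ≥0] ℝ≥0 :=
    { toFun := fun f => ⟨Λ f - ψ f, sub_nonneg.mpr (hΛ f)⟩
      map_add' := fun f g => NNReal.eq (by
        change ((Λ (f + g) : ℝ≥0) : ℝ) - ψ (f + g) = (Λ f - ψ f) + (Λ g - ψ g)
        rw [map_add, map_add]; push_cast; ring)
      map_smul' := fun c f => NNReal.eq (by
        change ((Λ (c • f) : ℝ≥0) : ℝ) - ψ (c • f) = c * (Λ f - ψ f)
        rw [map_smul, map_smul, smul_eq_mul, NNReal.smul_def, smul_eq_mul]; push_cast; ring) }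
  obtain ⟨ν₁, hν₁, h₁⟩ := exists_measure_of_linearMap Λ
  obtain ⟨ν₂, hν₂, h₂⟩ := exists_measure_of_linearMap Λ₂
  refine ⟨ν₁, ν₂, hν₁, hν₂, fun f => ?_⟩
  have hpos (g : C(Z, ℝ≥0)) : φ (ι g) = ∫ z, ι g z ∂ν₁ - ∫ z, ι g z ∂ν₂ := by
    have e₁ : ∫ z, ι g z ∂ν₁ = Λ g := h₁ g
    have e₂ : ∫ z, ι g z ∂ν₂ = Λ g - ψ g := h₂ g
    rw [e₁, e₂, sub_sub_cancel]; rfl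
  let P : C(Z, ℝ≥0) := ⟨fun z => (f z).toNNReal, by fun_prop⟩
  let N : C(Z, ℝ≥0) := ⟨fun z => (-f z).toNNReal, by fun_prop⟩
  have hf : f = ι P - ι N := by
    ext z
    simp only [ι, P, N, ContinuousMap.sub_apply, ContinuousMap.coe_mk, Real.coe_toNNReal']
    rcases le_total (f z) 0 with h | h <;> simp [h]
  rw [hf, map_sub, hpos, hpos]
  simp only [ContinuousMap.sub_apply]
  rw [integral_sub ((ι P).integrable_of_isFiniteMeasure _) ((ι N).integrable_of_isFiniteMeasure _),
    integral_sub ((ι P).integrable_of_isFiniteMeasure _) ((ι N).integrable_of_isFiniteMeasure _)]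
  ring

theorem span_integralFunctional :
    Submodule.span ℂ (Set.range fun ν : FiniteMeasure Z => integralFunctional (ν : Measure Z)) =
      ⊤ := by
  rw [eq_top_iff]
  intro φ _
  let ι : C(Z, ℝ) →L[ℝ] C(Z, ℂ) := Complex.ofRealCLM.compLeftContinuous ℝ Z
  let φR : C(Z, ℂ) →L[ℝ] ℂ := φ.restrictScalars ℝ
  obtain ⟨ν₁, ν₂, h₁, h₂, hre⟩ := exists_measure_sub (Complex.reCLM ∘L φR ∘L ι)
  obtain ⟨ν₃, ν₄, h₃, h₄, him⟩ := exists_measure_sub (Complex.imCLM ∘L φR ∘L ι)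
  have hφ : φ = integralFunctional ν₁ - integralFunctional ν₂ +
      Complex.I • (integralFunctional ν₃ - integralFunctional ν₄) := by
    have hreal (f : C(Z, ℝ)) : φ (ι f) = (integralFunctional ν₁ - integralFunctional ν₂ +
        Complex.I • (integralFunctional ν₃ - integralFunctional ν₄)) (ι f) := by
      have hi (ν : Measure Z) [IsFiniteMeasure ν] :
          integralFunctional ν (ι f) = ((∫ z, f z ∂ν : ℝ) : ℂ) := integral_ofReal
      have e₁ : (φ (ι f)).re = _ := hre f
      have e₂ : (φ (ι f)).im = _ := him f
      simp only [add_apply, sub_apply, smul_apply, hi]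
      apply Complex.ext <;> simp [e₁, e₂]
    ext f
    let a : C(Z, ℝ) := ⟨fun z => (f z).re, by fun_prop⟩
    let b : C(Z, ℝ) := ⟨fun z => (f z).im, by fun_prop⟩
    have hf : f = ι a + Complex.I • ι b := by
      ext z
      change f z = ((f z).re : ℂ) + Complex.I * ((f z).im : ℂ)
      rw [mul_comm, Complex.re_add_im]
    rw [hf, map_add, map_smul, map_add, map_smul, hreal, hreal]
  have hmem (ν : Measure Z) [h : IsFiniteMeasure ν] : integralFunctional ν ∈ Submodule.span ℂ
      (Set.range fun ν : FiniteMeasure Z => integralFunctional (ν : Measure Z)) :=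
    Submodule.subset_span ⟨⟨ν, h⟩, rfl⟩
  rw [hφ]
  exact add_mem (sub_mem (hmem _) (hmem _)) (Submodule.smul_mem _ _ (sub_mem (hmem _) (hmem _)))

/-- Elements of `C(Z)**` are determined by their values on positive measures. -/
theorem Bidual.ext_measure {F G : Bidual C(Z, ℂ)}
    (h : ∀ (ν : Measure Z) [IsFiniteMeasure ν],
      F (integralFunctional ν) = G (integralFunctional ν)) : F = G := by
  refine ContinuousLinearMap.coe_injective (LinearMap.ext_on span_integralFunctional ?_)
  rintro _ ⟨ν, rfl⟩
  exact h ν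

end Jordan

/-! ### The Arens product of `C(Z)**` -/

section Arens

open scoped NNReal ENNReal InnerProductSpace

theorem Bidual.mul_apply {B : Type*} [CStarAlgebra B] (G F : Bidual B) (φ : StrongDual ℂ B) :
    G.mul F φ = G (F.act φ) := rfl

theorem Bidual.act_mul {B : Type*} [CStarAlgebra B] (G F : Bidual B) (φ : StrongDual ℂ B) :
    (G.mul F).act φ = G.act (F.act φ) := by
  ext b
  rw [Bidual.act_apply, Bidual.act_apply, Bidual.mul_apply]
  congr 1
  ext c
  rw [Bidual.act_apply, ContinuousLinearMap.comp_apply, Bidual.act_apply]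
  congr 1
  ext d
  simp [_root_.mul_assoc]

theorem Bidual.mul_assoc {B : Type*} [CStarAlgebra B] (H G F : Bidual B) :
    (H.mul G).mul F = H.mul (G.mul F) := by
  ext φ
  rw [Bidual.mul_apply, Bidual.mul_apply, Bidual.mul_apply, Bidual.act_mul]

theorem inner_star_star_Lp {Z : Type*} [MeasurableSpace Z] (ν : Measure Z) (u v : Lp ℂ 2 ν) :
    ⟪star u, star v⟫_ℂ = ⟪v, u⟫_ℂ := by
  rw [L2.inner_def, L2.inner_def]
  refine integral_congr_ae ?_
  filter_upwards [Lp.coeFn_star u, Lp.coeFn_star v] with z hu hv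
  simp [hu, hv, mul_comm]

variable {Z : Type*} [TopologicalSpace Z] [CompactSpace Z] [MeasurableSpace Z] [BorelSpace Z]

/-! ### Elements of the bidual as square integrable functions -/

section Density

variable (ν : Measure Z) [IsFiniteMeasure ν]

theorem toLp_star (f : C(Z, ℂ)) :
    ContinuousMap.toLp 2 ν ℂ (star f) = star (ContinuousMap.toLp 2 ν ℂ f) := by
  refine Lp.ext ?_
  filter_upwards [Lp.coeFn_star (ContinuousMap.toLp 2 ν ℂ f), ContinuousMap.coeFn_toLp (p := 2) ν
    (𝕜 := ℂ) f,
    ContinuousMap.coeFn_toLp (p := 2) ν (𝕜 := ℂ) (star f)] with z h₁ h₂ h₃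
  rw [h₁, h₃, Pi.star_apply, h₂]
  rfl

/-- The functional `f ↦ ∫ f h dν` for a square integrable density `h`. -/
noncomputable def densityFunctional : Lp ℂ 2 ν →L[ℂ] StrongDual ℂ C(Z, ℂ) :=
  LinearMap.mkContinuous₂
    (LinearMap.mk₂ ℂ (fun (h : Lp ℂ 2 ν) (f : C(Z, ℂ)) => ⟪ContinuousMap.toLp 2 ν ℂ (star f), h⟫_ℂ)
      (fun h₁ h₂ f => inner_add_right _ _ _)
      (fun (c : ℂ) (h : Lp ℂ 2 ν) (f : C(Z, ℂ)) => inner_smul_right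
      (ContinuousMap.toLp 2 ν ℂ (star f)) h c)
      (fun h f₁ f₂ => by rw [star_add, map_add, inner_add_left])
      (fun c h f => by
        rw [star_smul, map_smul, inner_smul_left]
        simp))
    ‖(ContinuousMap.toLp 2 ν ℂ : C(Z, ℂ) →L[ℂ] Lp ℂ 2 ν)‖
    (fun h f => by
      refine (norm_inner_le_norm (𝕜 := ℂ) (ContinuousMap.toLp 2 ν ℂ (star f)) h).trans ?_
      rw [mul_right_comm]
      refine mul_le_mul_of_nonneg_right ?_ (norm_nonneg _)
      refine (ContinuousLinearMap.le_opNorm _ _).trans_eq ?_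
      rw [norm_star])

theorem densityFunctional_apply (h : Lp ℂ 2 ν) (f : C(Z, ℂ)) :
    densityFunctional ν h f = ⟪ContinuousMap.toLp 2 ν ℂ (star f), h⟫_ℂ := rfl

theorem densityFunctional_toLp (g : C(Z, ℂ)) :
    densityFunctional ν (ContinuousMap.toLp 2 ν ℂ g) =
      integralFunctional ν ∘L ContinuousLinearMap.mul ℂ C(Z, ℂ) g := by
  ext f
  rw [densityFunctional_apply, ContinuousMap.inner_toLp]
  change _ = ∫ z, g z * f z ∂ν
  simp

theorem dualStar_densityFunctional (h : Lp ℂ 2 ν) :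
    dualStar (densityFunctional ν h) = densityFunctional ν (star h) := by
  ext f
  rw [dualStar_apply, densityFunctional_apply, densityFunctional_apply, inner_conj_symm, star_star,
    toLp_star, inner_star_star_Lp]

/-- On functionals with a density in `L²(ν)`, `F` is a bounded functional of the density, so the
Riesz representation applies. As seen from `ν`, the element `F` is the function `star f`, and it
sends `ν` to `(star f) ν`. -/
theorem Bidual.exists_density (F : Bidual C(Z, ℂ)) :
    ∃ f : Lp ℂ 2 ν, (∀ h, F (densityFunctional ν h) = ⟪f, h⟫_ℂ) ∧
      F.act (integralFunctional ν) = densityFunctional ν (star f) := by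
  let f := (InnerProductSpace.toDual ℂ (Lp ℂ 2 ν)).symm (F ∘L densityFunctional ν)
  have hf (h : Lp ℂ 2 ν) : F (densityFunctional ν h) = ⟪f, h⟫_ℂ := by
    rw [InnerProductSpace.toDual_symm_apply]; rfl
  refine ⟨f, hf, ?_⟩
  ext b
  rw [Bidual.act_apply, ← densityFunctional_toLp, hf, densityFunctional_apply, toLp_star,
    inner_star_star_Lp]

/-- The value is `‖f‖²` for the vector `f` representing `F` in `L²(ν)`. -/
theorem Bidual.exists_conj_mul_self (F : Bidual C(Z, ℂ)) :
    ∃ t : ℝ≥0, F.conj.mul F (integralFunctional ν) = ((t : ℝ) : ℂ) := by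
  obtain ⟨f, hf, hact⟩ := F.exists_density ν
  refine ⟨‖f‖₊ ^ 2, ?_⟩
  rw [Bidual.mul_apply, hact, Bidual.conj_apply, dualStar_densityFunctional, star_star, hf,
    inner_conj_symm, inner_self_eq_norm_sq_to_K]
  simp

end Density

/-- At `ν` both products equal `∫ (star f) (star g) dν`, where `f`, `g` represent `F`, `G` in
`L²(ν)`. -/
theorem Bidual.mul_comm [T2Space Z] [SecondCountableTopology Z] (F G : Bidual C(Z, ℂ)) :
    F.mul G = G.mul F := by
  refine Bidual.ext_measure fun ν _ => ?_
  obtain ⟨f, hf, hF⟩ := F.exists_density ν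
  obtain ⟨g, hg, hG⟩ := G.exists_density ν
  rw [Bidual.mul_apply, Bidual.mul_apply, hF, hG, hf, hg, ← inner_star_star_Lp, star_star]

end Arens

/-! ### Bounded Borel functions in `C(Z)**` -/

section Borel

open scoped NNReal ENNReal

theorem integrable_coe_nnreal_of_le {Z : Type*} [MeasurableSpace Z] {r : Z → ℝ≥0} {C : ℝ≥0}
    (hr : Measurable r)
    (hC : ∀ z, r z ≤ C) (ν : Measure Z) [IsFiniteMeasure ν] : Integrable (fun z => (r z : ℝ)) ν :=
  Integrable.of_bound (by fun_prop) C (Filter.Eventually.of_forall fun z => by simpa using hC z)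

theorem isFiniteMeasure_withDensity_coe {Z : Type*} [MeasurableSpace Z] {r : Z → ℝ≥0} {C : ℝ≥0}
    (hC : ∀ z, r z ≤ C)
    (ν : Measure Z) [IsFiniteMeasure ν] :
    IsFiniteMeasure (ν.withDensity fun z => (r z : ℝ≥0∞)) := by
  refine isFiniteMeasure_withDensity (ne_top_of_le_ne_top ?_
    (lintegral_mono fun z => ENNReal.coe_le_coe.mpr (hC z)))
  rw [lintegral_const]
  exact ENNReal.mul_ne_top ENNReal.coe_ne_top (measure_ne_top _ _)

theorem dualStar_integralFunctional {Z : Type*} [TopologicalSpace Z]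
    [CompactSpace Z] [MeasurableSpace Z] [BorelSpace Z] (ν : Measure Z) [IsFiniteMeasure ν] :
    dualStar (integralFunctional ν) = integralFunctional ν := by
  ext f
  rw [dualStar_apply, integralFunctional_apply, integralFunctional_apply, ← integral_conj]
  simp

variable {Z : Type*} [TopologicalSpace Z] [CompactSpace Z] [T2Space Z] [SecondCountableTopology Z]
  [MeasurableSpace Z] [BorelSpace Z]

/-- A nonnegative continuous function as a complex-valued one. -/
def ofNNRealMap {Z : Type*} [TopologicalSpace Z] (g : C(Z, ℝ≥0)) : C(Z, ℂ) :=
  ⟨fun z => ((g z : ℝ) : ℂ), by fun_prop⟩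

/-- Nonnegative test functions `g` suffice, and for these `gν` is again a positive measure, on which
Borel elements can be evaluated. -/
theorem StrongDual.ext_nnreal {Z : Type*} [TopologicalSpace Z] [CompactSpace Z]
    {φ ψ : StrongDual ℂ C(Z, ℂ)} (h : ∀ g : C(Z, ℝ≥0), φ (ofNNRealMap g) = ψ (ofNNRealMap g)) :
    φ = ψ := by
  ext f
  have hf : f = ofNNRealMap ⟨fun z => (f z).re.toNNReal, by fun_prop⟩ -
      ofNNRealMap ⟨fun z => (-(f z).re).toNNReal, by fun_prop⟩ +
      Complex.I • (ofNNRealMap ⟨fun z => (f z).im.toNNReal, by fun_prop⟩ -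
        ofNNRealMap ⟨fun z => (-(f z).im).toNNReal, by fun_prop⟩) := by
    have hx (x : ℝ) : ((x.toNNReal : ℝ) : ℂ) - (((-x).toNNReal : ℝ) : ℂ) = x := by
      rw [Real.coe_toNNReal', Real.coe_toNNReal', ← Complex.ofReal_sub]
      rcases le_total x 0 with h | h <;> simp [h]
    ext z
    change f z = (((f z).re.toNNReal : ℝ) : ℂ) - (((-(f z).re).toNNReal : ℝ) : ℂ) +
      Complex.I * ((((f z).im.toNNReal : ℝ) : ℂ) - (((-(f z).im).toNNReal : ℝ) : ℂ))
    rw [hx, hx, mul_comm, Complex.re_add_im]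
  rw [hf]
  simp only [map_add, map_sub, map_smul, h]

/-- Continuous functions with values in `[0, C]` are dense in `L¹` in the set of Borel functions
with values in `[0, C]`. -/
theorem exists_continuousMap_integral_sub_le {r : Z → ℝ≥0} {C : ℝ≥0} (hr : Measurable r)
    (hC : ∀ z, r z ≤ C) (ν : Measure Z) [IsFiniteMeasure ν] {ε : ℝ} (hε : 0 < ε) :
    ∃ f : C(Z, ℝ), (∀ z, f z ∈ Set.Icc (0 : ℝ) C) ∧ ∫ z, |(r z : ℝ) - f z| ∂ν ≤ ε := by
  obtain ⟨g, hg, hgi⟩ := (integrable_coe_nnreal_of_le hr hC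
    ν).exists_boundedContinuous_integral_sub_le hε
  -- Truncation to `[0, C]` is a contraction that fixes the values of `r`, so it does not increase
  -- the distance to `r`.
  let f : C(Z, ℝ) := ⟨fun z => max 0 (min (g z) C), by fun_prop⟩
  refine ⟨f, fun z => ⟨le_max_left _ _, max_le C.2 (min_le_right _ _)⟩, le_trans ?_ hg⟩
  refine integral_mono ?_ ?_ fun z => ?_
  · exact ((integrable_coe_nnreal_of_le hr hC ν).sub (f.integrable_of_isFiniteMeasure ν)).abs
  · exact ((integrable_coe_nnreal_of_le hr hC ν).sub hgi).norm
  · have h1 : (0 : ℝ) ≤ r z := (r z).2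
    have h2 : (r z : ℝ) ≤ C := hC z
    change |(r z : ℝ) - max 0 (min (g z) C)| ≤ |(r z : ℝ) - g z|
    have h3 : (r z : ℝ) = max 0 (min (r z : ℝ) C) := by rw [min_eq_left h2, max_eq_right h1]
    calc |(r z : ℝ) - max 0 (min (g z) C)|
        = |max 0 (min (r z : ℝ) C) - max 0 (min (g z) C)| := by rw [← h3]
      _ ≤ |min (r z : ℝ) C - min (g z) C| := by
          simpa using abs_max_sub_max_le_max 0 (min (r z : ℝ) C) 0 (min (g z) C)
      _ ≤ |(r z : ℝ) - g z| := by
          simpa using abs_min_sub_min_le_max (r z : ℝ) C (g z) C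

/-- For a continuous function with values in `[0, C]` this is the definition of the dual norm; the
Borel case follows by `L¹` approximation. The bound makes integration of `r` well defined and
continuous on the span of the measures. -/
theorem norm_linearCombination_integral_le {r : Z → ℝ≥0} {C : ℝ≥0} (hr : Measurable r)
    (hC : ∀ z, r z ≤ C) (c : FiniteMeasure Z →₀ ℂ) :
    ‖Finsupp.linearCombination ℂ
        (fun ν : FiniteMeasure Z => ((∫ z, (r z : ℝ) ∂(ν : Measure Z) : ℝ) : ℂ)) c‖ ≤
      C * ‖Finsupp.linearCombination ℂ
        (fun ν : FiniteMeasure Z => integralFunctional (ν : Measure Z)) c‖ := by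
  set φ := Finsupp.linearCombination ℂ
    (fun ν : FiniteMeasure Z => integralFunctional (ν : Measure Z)) c with hφ
  refine le_of_forall_pos_le_add fun ε hε => ?_
  let s : ℝ := ∑ ν ∈ c.support, ‖c ν‖
  have hs : 0 ≤ s := Finset.sum_nonneg fun _ _ => norm_nonneg _
  -- The sum dominates each measure involved, so one continuous function approximates `r` for all of
  -- them. Dividing by `s + 1` rather than `s` covers the case `s = 0`.
  let m : FiniteMeasure Z := ∑ ν ∈ c.support, ν
  obtain ⟨f, hf, hfm⟩ := exists_continuousMap_integral_sub_le hr hC (m : Measure Z)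
    (show 0 < ε / (s + 1) by positivity)
  let F : C(Z, ℂ) := ⟨fun z => (f z : ℂ), by fun_prop⟩
  have hF : ‖F‖ ≤ C := by
    rw [ContinuousMap.norm_le _ C.coe_nonneg]
    intro z
    change ‖((f z : ℝ) : ℂ)‖ ≤ C
    rw [Complex.norm_real, Real.norm_of_nonneg (hf z).1]
    exact (hf z).2
  have hφF : φ F = ∑ ν ∈ c.support, c ν * ((∫ z, f z ∂(ν : Measure Z) : ℝ) : ℂ) := by
    rw [hφ, Finsupp.linearCombination_apply, Finsupp.sum, sum_apply]
    refine Finset.sum_congr rfl fun ν _ => ?_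
    change c ν * ∫ z, (f z : ℂ) ∂(ν : Measure Z) = _
    rw [integral_complex_ofReal]
  have hdiff (ν : FiniteMeasure Z) (hν : ν ∈ c.support) :
      |∫ z, (r z : ℝ) ∂(ν : Measure Z) - ∫ z, f z ∂(ν : Measure Z)| ≤ ε / (s + 1) := by
    have hle : (ν : Measure Z) ≤ m := by
      rw [FiniteMeasure.toMeasure_sum]
      exact Finset.single_le_sum (f := fun ν : FiniteMeasure Z => (ν : Measure Z))
        (fun _ _ => Measure.zero_le _) hν
    have hi (ν : Measure Z) [IsFiniteMeasure ν] : Integrable (fun z => (r z : ℝ) - f z) ν :=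
      (integrable_coe_nnreal_of_le hr hC _).sub (f.integrable_of_isFiniteMeasure _)
    rw [← integral_sub (integrable_coe_nnreal_of_le hr hC _) (f.integrable_of_isFiniteMeasure _)]
    refine abs_integral_le_integral_abs.trans (le_trans ?_ hfm)
    exact integral_mono_measure hle (Filter.Eventually.of_forall fun _ => abs_nonneg _)
      (hi _).abs
  have hsplit : Finsupp.linearCombination ℂ
        (fun ν : FiniteMeasure Z => ((∫ z, (r z : ℝ) ∂(ν : Measure Z) : ℝ) : ℂ)) c =
      φ F + ∑ ν ∈ c.support, c ν * ((∫ z, (r z : ℝ) ∂(ν : Measure Z) -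
        ∫ z, f z ∂(ν : Measure Z) : ℝ) : ℂ) := by
    rw [hφF, ← Finset.sum_add_distrib, Finsupp.linearCombination_apply, Finsupp.sum]
    refine Finset.sum_congr rfl fun ν _ => ?_
    rw [smul_eq_mul]; push_cast; ring
  rw [hsplit]
  refine (norm_add_le _ _).trans (add_le_add ?_ ?_)
  · rw [mul_comm]
    exact (φ.le_opNorm F).trans (mul_le_mul_of_nonneg_left hF (norm_nonneg _))
  · calc _ ≤ ∑ ν ∈ c.support, ‖c ν‖ * (ε / (s + 1)) := by
          refine (norm_sum_le _ _).trans (Finset.sum_le_sum fun ν hν => ?_)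
          rw [norm_mul, Complex.norm_real]
          exact mul_le_mul_of_nonneg_left (hdiff ν hν) (norm_nonneg _)
      _ = s * (ε / (s + 1)) := by rw [Finset.sum_mul]
      _ ≤ ε := by
          rw [mul_div_assoc', div_le_iff₀ (by positivity)]
          nlinarith

theorem exists_borelElement {r : Z → ℝ≥0} {C : ℝ≥0} (hr : Measurable r) (hC : ∀ z, r z ≤ C) :
    ∃ F : Bidual C(Z, ℂ), ∀ (ν : Measure Z) [IsFiniteMeasure ν],
      F (integralFunctional ν) = ((∫ z, (r z : ℝ) ∂ν : ℝ) : ℂ) := by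
  let T := Finsupp.linearCombination ℂ
    (fun ν : FiniteMeasure Z => integralFunctional (ν : Measure Z))
  let R := Finsupp.linearCombination ℂ
    (fun ν : FiniteMeasure Z => ((∫ z, (r z : ℝ) ∂(ν : Measure Z) : ℝ) : ℂ))
  have hRT (c) : ‖R c‖ ≤ C * ‖T c‖ := norm_linearCombination_integral_le hr hC c
  have hT : LinearMap.range T = ⊤ := by
    rw [Finsupp.range_linearCombination, span_integralFunctional]
  -- Any linear section will do: by `hRT` the kernel of `T` lies in that of `R`, so `R ∘ σ` does not
  -- depend on `σ`.
  obtain ⟨σ, hσ⟩ := T.exists_rightInverse_of_surjective hT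
  have hσT (φ) : T (σ φ) = φ := LinearMap.congr_fun hσ φ
  refine ⟨LinearMap.mkContinuous (R ∘ₗ σ) C fun φ => ?_, fun ν hν => ?_⟩
  · have h := hRT (σ φ)
    rwa [hσT] at h
  · let c : FiniteMeasure Z →₀ ℂ := Finsupp.single ⟨ν, hν⟩ 1
    have hTc : T c = integralFunctional ν := by
      rw [show T c = _ from Finsupp.linearCombination_single ℂ _ _, one_smul]; rfl
    have hRc : R c = ((∫ z, (r z : ℝ) ∂ν : ℝ) : ℂ) := by
      rw [show R c = _ from Finsupp.linearCombination_single ℂ _ _, one_smul]; rfl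
    change R (σ (integralFunctional ν)) = _
    have h := hRT (σ (T c) - c)
    rw [map_sub, map_sub, hσT, sub_self, norm_zero, mul_zero, hRc, hTc] at h
    exact sub_eq_zero.mp (norm_le_zero_iff.mp h)

open scoped Classical in
/-- The element of `C(Z)**` given by a bounded nonnegative Borel function. -/
noncomputable def borelElement (r : Z → ℝ≥0) : Bidual C(Z, ℂ) :=
  -- The value `0` is a dummy, never taken for bounded measurable `r`, by `exists_borelElement`.
  if h : ∃ F : Bidual C(Z, ℂ), ∀ (ν : Measure Z) [IsFiniteMeasure ν],
      F (integralFunctional ν) = ((∫ z, (r z : ℝ) ∂ν : ℝ) : ℂ) then h.choose else 0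

theorem borelElement_apply {r : Z → ℝ≥0} {C : ℝ≥0} (hr : Measurable r) (hC : ∀ z, r z ≤ C)
    (ν : Measure Z) [IsFiniteMeasure ν] :
    borelElement r (integralFunctional ν) = ((∫ z, (r z : ℝ) ∂ν : ℝ) : ℂ) := by
  have h := exists_borelElement hr hC
  rw [borelElement, dif_pos h]
  exact h.choose_spec ν

theorem borelElement_act {r : Z → ℝ≥0} {C : ℝ≥0} (hr : Measurable r) (hC : ∀ z, r z ≤ C)
    (ν : Measure Z) [IsFiniteMeasure ν]
    [IsFiniteMeasure (ν.withDensity fun z => (r z : ℝ≥0∞))] :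
    (borelElement r).act (integralFunctional ν) =
      integralFunctional (ν.withDensity fun z => (r z : ℝ≥0∞)) := by
  refine StrongDual.ext_nnreal fun g => ?_
  have hg (z : Z) : g z ≤ ‖ofNNRealMap g‖₊ := by
    have h := (ofNNRealMap g).norm_coe_le_norm z
    rwa [show ofNNRealMap g z = ((g z : ℝ) : ℂ) from rfl, Complex.norm_real, NNReal.norm_eq] at h
  have := isFiniteMeasure_withDensity_coe hg ν
  have hcomp : integralFunctional ν ∘L ContinuousLinearMap.mul ℂ C(Z, ℂ) (ofNNRealMap g) =
      integralFunctional (ν.withDensity fun z => (g z : ℝ≥0∞)) := by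
    ext f
    change ∫ z, ((g z : ℝ) : ℂ) * f z ∂ν = ∫ z, f z ∂(ν.withDensity fun z => (g z : ℝ≥0∞))
    rw [integral_withDensity_eq_integral_smul g.continuous.measurable]
    rfl
  rw [Bidual.act_apply, hcomp, borelElement_apply hr hC, integralFunctional_apply,
    integral_withDensity_eq_integral_smul g.continuous.measurable,
    integral_withDensity_eq_integral_smul hr, ← integral_complex_ofReal]
  refine integral_congr_ae (Filter.Eventually.of_forall fun z => ?_)
  simp [NNReal.smul_def, ofNNRealMap, mul_comm]

theorem borelElement_mul {r s : Z → ℝ≥0} {C D : ℝ≥0} (hr : Measurable r) (hC : ∀ z, r z ≤ C)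
    (hs : Measurable s) (hD : ∀ z, s z ≤ D) :
    (borelElement r).mul (borelElement s) = borelElement (fun z => r z * s z) := by
  refine Bidual.ext_measure fun ν _ => ?_
  have := isFiniteMeasure_withDensity_coe hD ν
  rw [Bidual.mul_apply, borelElement_act hs hD, borelElement_apply hr hC,
    borelElement_apply (r := fun z => r z * s z) (hr.mul hs) (C := C * D)
    (fun z => mul_le_mul' (hC z) (hD z)),
    integral_withDensity_eq_integral_smul hs]
  congr 1
  refine integral_congr_ae (Filter.Eventually.of_forall fun z => ?_)
  simp [NNReal.smul_def, mul_comm]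

theorem borelElement_conj {r : Z → ℝ≥0} {C : ℝ≥0} (hr : Measurable r) (hC : ∀ z, r z ≤ C) :
    (borelElement r).conj = borelElement r := by
  refine Bidual.ext_measure fun ν _ => ?_
  rw [Bidual.conj_apply, dualStar_integralFunctional, borelElement_apply hr hC,
    Complex.conj_ofReal]

end Borel

/-! ### The fibre measures of a weighted branched covering -/

section FibreMeasure

open scoped NNReal ENNReal

variable {X Y : Type*} [TopologicalSpace X] [TopologicalSpace Y]

/-- The weight function with values in `ℝ≥0`. -/
def WeightFunction.weight {p : C(Y, X)} (w : WeightFunction p) (y : Y) : ℝ≥0 :=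
  ⟨w.μ y, (w.mem_Icc y).1⟩

theorem WeightFunction.coe_weight {p : C(Y, X)} (w : WeightFunction p) (y : Y) :
    (w.weight y : ℝ) = w.μ y := rfl

theorem WeightFunction.weight_le_one {p : C(Y, X)} (w : WeightFunction p) (y : Y) :
    w.weight y ≤ 1 := (w.mem_Icc y).2

theorem WeightFunction.exists_inv_weight_le {p : C(Y, X)} (w : WeightFunction p) :
    ∃ C : ℝ≥0, ∀ y, (w.weight y)⁻¹ ≤ C := by
  obtain ⟨c, hc, hcμ⟩ := w.bounded_below
  refine ⟨(⟨c, hc.le⟩ : ℝ≥0)⁻¹, fun y => ?_⟩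
  exact inv_anti₀ (NNReal.coe_pos.mp hc) (hcμ y)

theorem WeightFunction.weight_ne_zero {p : C(Y, X)} (w : WeightFunction p) (y : Y) :
    w.weight y ≠ 0 := by
  obtain ⟨c, hc, hcμ⟩ := w.bounded_below
  exact fun h => (hc.trans_le (hcμ y)).ne' (congrArg NNReal.toReal h)

theorem integralFunctional_comp_pullback [CompactSpace X] [MeasurableSpace X]
    [BorelSpace X] [CompactSpace Y] [MeasurableSpace Y] [BorelSpace Y] (p : C(Y, X))
    (ν : Measure Y) [IsFiniteMeasure ν] :
    integralFunctional ν ∘L starHomCLM (ContinuousMap.compStarAlgHom' ℂ ℂ p) =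
      integralFunctional (ν.map p) := by
  ext f
  change ∫ y, f (p y) ∂ν = ∫ x, f x ∂(ν.map p)
  rw [integral_map p.continuous.aemeasurable f.continuous.aestronglyMeasurable]

variable {p : C(Y, X)} (hp : IsBranchedCovering p) (w : WeightFunction p)

theorem sum_weight (x : X) : ∑ y ∈ (hp.finite x).toFinset, w.weight y = 1 := by
  have h := w.sum_eq_one x
  rw [finsum_mem_eq_finite_toFinset_sum _ (hp.finite x)] at h
  refine NNReal.eq ?_
  rw [NNReal.coe_sum]
  exact h

theorem weightedExpectation_apply_sum [CompactSpace X] [CompactSpace Y] (f : C(Y, ℂ)) (x : X) :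
    weightedExpectation hp w f x =
      ∑ y ∈ (hp.finite x).toFinset, f y * ((w.weight y : ℝ) : ℂ) := by
  rw [weightedExpectation_apply, finsum_mem_eq_finite_toFinset_sum _ (hp.finite x)]
  rfl

section Measure

variable [MeasurableSpace Y]

/-- The measure `∑_{p(y) = x} μ(y) δ_y`. -/
noncomputable def fibreMeasure (x : X) : Measure Y :=
  ∑ y ∈ (hp.finite x).toFinset, w.weight y • Measure.dirac y

theorem lintegral_fibreMeasure {g : Y → ℝ≥0∞} (hg : Measurable g) (x : X) :
    ∫⁻ y, g y ∂(fibreMeasure hp w x) = ∑ y ∈ (hp.finite x).toFinset, w.weight y * g y := by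
  rw [fibreMeasure, lintegral_finsetSum_measure]
  refine Finset.sum_congr rfl fun y _ => ?_
  rw [lintegral_smul_measure, lintegral_dirac' _ hg]
  rfl

instance isProbabilityMeasure_fibreMeasure (x : X) : IsProbabilityMeasure (fibreMeasure hp w x)
    where
  measure_univ := by
    rw [← lintegral_one, lintegral_fibreMeasure hp w measurable_const]
    simp only [mul_one]
    rw [← ENNReal.ofNNReal_finsetSum, sum_weight hp w, ENNReal.coe_one]

variable [CompactSpace X] [CompactSpace Y] [T2Space Y] [SecondCountableTopology Y] [BorelSpace Y]

theorem integral_fibreMeasure (f : C(Y, ℂ)) (x : X) :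
    ∫ y, f y ∂(fibreMeasure hp w x) = weightedExpectation hp w f x := by
  rw [weightedExpectation_apply_sum, fibreMeasure, integral_finsetSum_measure]
  · refine Finset.sum_congr rfl fun y _ => ?_
    rw [integral_smul_nnreal_measure, integral_dirac, NNReal.smul_def, Complex.real_smul, mul_comm]
  · intro y _
    exact f.integrable_of_isFiniteMeasure _

variable [MeasurableSpace X] [BorelSpace X]

/-- Closed sets form a generating π-system, and the indicator of a closed set is a pointwise limit
of continuous functions. Their fibre integrals are values of `E_μ`, hence continuous in `x`. -/
theorem measurable_fibreMeasure : Measurable (fibreMeasure hp w) := by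
  refine Measurable.measure_of_isPiSystem_of_isProbabilityMeasure
    ((BorelSpace.measurable_eq (α := Y)).trans borel_eq_generateFrom_isClosed) isPiSystem_isClosed
    ?_
  intro F hF
  have hF : IsClosed F := hF
  refine measurable_of_tendsto_metrizable (f := fun n x => ∫⁻ y, hF.apprSeq n y
    ∂(fibreMeasure hp w x))
    (fun n => ?_) (tendsto_pi_nhds.mpr fun x => HasOuterApproxClosed.tendsto_lintegral_apprSeq hF _)
  let f : C(Y, ℂ) := ⟨fun y => ((hF.apprSeq n y : ℝ) : ℂ), by fun_prop⟩
  have h (x : X) : ∫⁻ y, hF.apprSeq n y ∂(fibreMeasure hp w x) =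
      ENNReal.ofReal (weightedExpectation hp w f x).re := by
    rw [lintegral_fibreMeasure hp w (by fun_prop), weightedExpectation_apply_sum]
    have : ∑ y ∈ (hp.finite x).toFinset, f y * ((w.weight y : ℝ) : ℂ) =
        ((∑ y ∈ (hp.finite x).toFinset, w.weight y * hF.apprSeq n y : ℝ≥0) : ℝ) := by
      push_cast
      exact Finset.sum_congr rfl fun y _ => mul_comm _ _
    rw [this, Complex.ofReal_re, ENNReal.ofReal_coe_nnreal]
    push_cast
    rfl
  simp only [h]
  have := (weightedExpectation hp w f).continuous
  fun_prop

theorem integralFunctional_comp_weightedExpectation (ν : Measure X) [IsFiniteMeasure ν]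
    [IsFiniteMeasure (ν.bind (fibreMeasure hp w))] :
    integralFunctional ν ∘L weightedExpectation hp w =
      integralFunctional (ν.bind (fibreMeasure hp w)) := by
  ext f
  -- `ν.bind` is viewed as the composite of this kernel with a constant one, so that Fubini for
  -- kernels applies.
  let κ : ProbabilityTheory.Kernel X Y := ⟨fibreMeasure hp w, measurable_fibreMeasure hp w⟩
  have h : ∫ y, f y ∂((κ.comp (ProbabilityTheory.Kernel.const Unit ν)) ()) =
      ∫ x, ∫ y, f y ∂(κ x) ∂ν :=
    ProbabilityTheory.Kernel.integral_comp (a := ()) (f := f) (η := κ)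
      (κ := ProbabilityTheory.Kernel.const Unit ν) (f.integrable_of_isFiniteMeasure
      (ν.bind (fibreMeasure hp w)))
  change ∫ x, weightedExpectation hp w f x ∂ν = ∫ y, f y ∂(ν.bind (fibreMeasure hp w))
  refine Eq.trans ?_ h.symm
  simp only [← integral_fibreMeasure]
  rfl

theorem isFiniteMeasure_bind_fibreMeasure (ν : Measure X) [IsFiniteMeasure ν] :
    IsFiniteMeasure (ν.bind (fibreMeasure hp w)) := by
  constructor
  rw [Measure.bind_apply MeasurableSet.univ (measurable_fibreMeasure hp w).aemeasurable]
  simp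

/-- Mass at `y ∈ P` is spread over the fibre through `y` with weights `μ`. Only `y` itself survives
the factor `h`, since no other point of that fibre lies in `P`. -/
theorem withDensity_bind_fibreMeasure {P : Set Y}
    (hP : Set.InjOn p P) {g h : Y → ℝ≥0} (hg : Measurable g) (hh : Measurable h)
    (hgP : ∀ y ∉ P, g y = 0) (hhP : ∀ y ∉ P, h y = 0) (ν : Measure Y) :
    (((ν.withDensity fun y => (g y : ℝ≥0∞)).map p).bind (fibreMeasure hp w)).withDensity
        (fun y => (h y : ℝ≥0∞)) =
      ν.withDensity fun y => ((g y * w.weight y * h y : ℝ≥0) : ℝ≥0∞) := by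
  ext A hA
  have hm : Measurable (A.indicator fun y => (h y : ℝ≥0∞)) :=
    hh.coe_nnreal_ennreal.indicator hA
  have hκ := measurable_fibreMeasure hp w
  have hI : Measurable fun x => ∫⁻ y, A.indicator (fun y => (h y : ℝ≥0∞)) y ∂(fibreMeasure hp w x)
    :=
    (Measure.measurable_lintegral hm).comp hκ
  have hIp : Measurable fun y =>
      ∫⁻ y', A.indicator (fun y => (h y : ℝ≥0∞)) y' ∂(fibreMeasure hp w (p y)) :=
    hI.comp p.continuous.measurable
  rw [withDensity_apply _ hA, withDensity_apply _ hA, ← lintegral_indicator hA,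
    ← lintegral_indicator hA, Measure.lintegral_bind hκ.aemeasurable hm.aemeasurable,
    lintegral_map hI p.continuous.measurable,
    lintegral_withDensity_eq_lintegral_mul _ hg.coe_nnreal_ennreal hIp]
  refine lintegral_congr fun y => ?_
  rw [Pi.mul_apply, lintegral_fibreMeasure hp w hm]
  by_cases hy : y ∈ P
  · rw [Finset.sum_eq_single_of_mem y (by simp)]
    · by_cases hyA : y ∈ A
      · simp [hyA, mul_assoc]
      · simp [hyA]
    · intro y' hy' hne
      have hnot : y' ∉ P := fun h' => hne (hP h' hy (by simpa using hy'))
      have h0 : A.indicator (fun y => (h y : ℝ≥0∞)) y' = 0 := by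
        by_cases h' : y' ∈ A <;> simp [h', hhP y' hnot]
      rw [h0, mul_zero]
  · by_cases h' : y ∈ A <;> simp [h', hgP y hy]

/-- On a set that meets each fibre at most once, the conditional expectation is the
multiplication by the weight. -/
theorem biadjoint_mul_borelElement (hw : Measurable w.weight) {P : Set Y}
    (hP : Set.InjOn p P) {g h : Y → ℝ≥0} {C D : ℝ≥0} (hg : Measurable g) (hh : Measurable h)
    (hC : ∀ y, g y ≤ C) (hD : ∀ y, h y ≤ D)
    (hgP : ∀ y ∉ P, g y = 0) (hhP : ∀ y ∉ P, h y = 0) (x : Bidual C(Y, ℂ)) :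
    (biadjoint (starHomCLM (ContinuousMap.compStarAlgHom' ℂ ℂ p))
      (biadjoint (weightedExpectation hp w) (x.mul (borelElement h)))).mul (borelElement g) =
      x.mul (borelElement fun y => g y * w.weight y * h y) := by
  refine Bidual.ext_measure fun ν _ => ?_
  have hb (y : Y) : g y * w.weight y * h y ≤ C * 1 * D :=
    mul_le_mul' (mul_le_mul' (hC y) (w.weight_le_one y)) (hD y)
  have := isFiniteMeasure_withDensity_coe hC ν
  have := isFiniteMeasure_withDensity_coe hb ν
  have := isFiniteMeasure_bind_fibreMeasure hp w ((ν.withDensity fun y => (g y : ℝ≥0∞)).map p)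
  have := isFiniteMeasure_withDensity_coe hD
    (((ν.withDensity fun y => (g y : ℝ≥0∞)).map p).bind (fibreMeasure hp w))
  rw [Bidual.mul_apply, borelElement_act hg hC, biadjoint_apply, integralFunctional_comp_pullback,
    biadjoint_apply, integralFunctional_comp_weightedExpectation, Bidual.mul_apply,
    borelElement_act hh hD, Bidual.mul_apply, borelElement_act
    (r := fun y => g y * w.weight y * h y) ((hg.mul hw).mul hh) hb]
  congr 2
  exact withDensity_bind_fibreMeasure hp w hP hg hh hgP hhP ν

end Measure

end FibreMeasure

/-! ### Regular decompositions -/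

section Decomposition

open scoped NNReal ENNReal Topology

variable {X Y : Type*} [TopologicalSpace X] [TopologicalSpace Y] {p : C(Y, X)}

/-- Disjoint neighbourhoods of the points of the fibre have open images, so every nearby fibre meets
all of them. Hence a stratum is a difference of two open sets. -/
theorem IsBranchedCovering.eventually_encard_le [T2Space Y] (hp : IsBranchedCovering p) (x : X) :
    ∀ᶠ x' in 𝓝 x, (p ⁻¹' {x}).encard ≤ (p ⁻¹' {x'}).encard := by
  obtain ⟨U, hU, hd⟩ := (hp.finite x).t2_separation
  have hev : ∀ᶠ x' in 𝓝 x, ∀ y ∈ p ⁻¹' {x}, x' ∈ p '' U y := by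
    refine (Filter.eventually_all_finite (hp.finite x)).mpr fun y hy => ?_
    refine (hp.isOpenMap _ (hU y).2).mem_nhds ⟨y, (hU y).1, hy⟩
  filter_upwards [hev] with x' hx'
  have : ∀ y : Y, ∃ y', y ∈ p ⁻¹' {x} → y' ∈ U y ∧ p y' = x' := fun y => by
    by_cases hy : y ∈ p ⁻¹' {x}
    · obtain ⟨y', h⟩ := hx' y hy
      exact ⟨y', fun _ => h⟩
    · exact ⟨y, fun h => absurd h hy⟩
  choose c hc using this
  refine Set.encard_le_encard_of_injOn (f := c) (fun y hy => (hc y hy).2) ?_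
  intro y hy y' hy' h
  by_contra hne
  exact Set.disjoint_left.mp (hd hy hy' hne) (hc y hy).1 (h ▸ (hc y' hy').1)

theorem IsBranchedCovering.isOpen_le_encard [T2Space Y] (hp : IsBranchedCovering p) (n : ℕ∞) :
    IsOpen {x | n ≤ (p ⁻¹' {x}).encard} := by
  rw [isOpen_iff_mem_nhds]
  intro x hx
  filter_upwards [hp.eventually_encard_le x] with x' hx'
  exact le_trans hx hx'

theorem IsBranchedCovering.measurableSet_stratum [T2Space Y] [MeasurableSpace X] [BorelSpace X]
    (hp : IsBranchedCovering p) (j : ℕ) : MeasurableSet (stratum p j) := by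
  have h : stratum p j =
      {x | (j : ℕ∞) ≤ (p ⁻¹' {x}).encard} \ {x | ((j + 1 : ℕ) : ℕ∞) ≤ (p ⁻¹' {x}).encard} := by
    ext x
    obtain ⟨n, hn⟩ := ENat.ne_top_iff_exists.mp (hp.finite x).encard_lt_top.ne
    simp only [stratum, Set.mem_ofPred_eq, Set.mem_sdiff, ← hn, Nat.cast_le, Nat.cast_inj]
    omega
  rw [h]
  exact (hp.isOpen_le_encard _).measurableSet.diff (hp.isOpen_le_encard _).measurableSet

theorem IsBranchedCovering.exists_isRegularNhd [T2Space Y] (hp : IsBranchedCovering p) {j : ℕ}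
    {x : X} (hx : x ∈ stratum p j) :
    ∃ (U : Set X) (V : Fin j → Set Y), IsRegularNhd p x U V ∧ ∀ t, U ⊆ p '' V t := by
  have hcard : Nat.card (p ⁻¹' {x}) = j := by
    rw [Nat.card_coe_set_eq, Set.ncard, show (p ⁻¹' {x}).encard = j from hx, ENat.toNat_natCast]
  have := (hp.finite x).to_subtype
  let e : Fin j ≃ (p ⁻¹' {x}) := (Finite.equivFinOfCardEq hcard).symm
  let y : Fin j → Y := fun t => e t
  have hy (t) : p (y t) = x := (e t).2
  have hyinj : Function.Injective y := Subtype.val_injective.comp e.injective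
  have hyr : Set.range y = p ⁻¹' {x} := by
    ext z
    refine ⟨?_, fun hz => ⟨e.symm ⟨z, hz⟩, by simp [y]⟩⟩
    rintro ⟨t, rfl⟩
    exact hy t
  obtain ⟨W, hW, hd⟩ := (hp.finite x).t2_separation
  have hWo : IsOpen (⋃ t, W (y t)) := isOpen_iUnion fun t => (hW _).2
  -- The first factor, open because `p` is closed, keeps whole fibres inside the `W (y t)`. The
  -- second, open because `p` is open, makes each fibre meet every `W (y t)`.
  let U : Set X := (p '' (⋃ t, W (y t))ᶜ)ᶜ ∩ ⋂ t, p '' W (y t)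
  have hU : IsOpen U := (hp.isClosedMap _ hWo.isClosed_compl).isOpen_compl.inter
    (isOpen_iInter_of_finite fun t => hp.isOpenMap _ (hW _).2)
  refine ⟨U, fun t => W (y t) ∩ p ⁻¹' U, ⟨hU, ⟨?_, ?_⟩, fun t => ?_, fun s t hst => ?_, ?_, ?_⟩, ?_⟩
  · rintro ⟨z, hz, hzx⟩
    have : z ∈ Set.range y := hyr ▸ hzx
    obtain ⟨t, rfl⟩ := this
    exact hz (Set.mem_iUnion.mpr ⟨t, (hW _).1⟩)
  · exact Set.mem_iInter.mpr fun t => ⟨y t, (hW _).1, hy t⟩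
  · exact (hW _).2.inter (hU.preimage p.continuous)
  · exact (hd (hy s) (hy t) (hyinj.ne hst)).mono Set.inter_subset_left Set.inter_subset_left
  · ext z
    refine ⟨fun hz => ?_, fun hz => ?_⟩
    · by_contra h
      refine hz.1 ⟨z, fun hz' => h ?_, rfl⟩
      obtain ⟨t, ht⟩ := Set.mem_iUnion.mp hz'
      exact Set.mem_iUnion.mpr ⟨t, ht, hz⟩
    · obtain ⟨t, ht⟩ := Set.mem_iUnion.mp hz
      exact ht.2
  · refine ⟨y, hyinj, hyr, fun t => ⟨(hW _).1, ?_⟩⟩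
    rw [Set.mem_preimage, hy t]
    refine ⟨?_, Set.mem_iInter.mpr fun t => ⟨y t, (hW _).1, hy t⟩⟩
    rintro ⟨z, hz, hzx⟩
    have : z ∈ Set.range y := hyr ▸ hzx
    obtain ⟨t, rfl⟩ := this
    exact hz (Set.mem_iUnion.mpr ⟨t, (hW _).1⟩)
  · intro t x' hx'
    obtain ⟨z, hz, rfl⟩ := Set.mem_iInter.mp hx'.2 t
    exact ⟨z, ⟨hz, hx'⟩, rfl⟩

/-- A single stratum has a regular decomposition. -/
theorem IsBranchedCovering.exists_stratum_decomposition [T2Space Y] [SecondCountableTopology X]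
    (hp : IsBranchedCovering p) (j : ℕ) :
    ∃ (U : ℕ → Set X) (V : ℕ → Fin j → Set Y), stratum p j ⊆ ⋃ s, U s ∧ (∀ s, IsOpen (U s)) ∧
      ∀ s, (U s).Nonempty → (∃ x ∈ stratum p j, IsRegularNhd p x (U s) (V s)) ∧
        ∀ t, U s ⊆ p '' V s t := by
  rcases (stratum p j).eq_empty_or_nonempty with h | h
  · exact ⟨fun _ => ∅, fun _ _ => ∅, by simp [h], fun _ => isOpen_empty,
      fun _ h => absurd h Set.not_nonempty_empty⟩
  have hex (x : X) : ∃ (U : Set X) (V : Fin j → Set Y), x ∈ stratum p j →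
      IsRegularNhd p x U V ∧ ∀ t, U ⊆ p '' V t := by
    by_cases hx : x ∈ stratum p j
    · obtain ⟨U, V, h⟩ := hp.exists_isRegularNhd hx
      exact ⟨U, V, fun _ => h⟩
    · exact ⟨∅, fun _ => ∅, fun h => absurd h hx⟩
  choose U V hUV using hex
  obtain ⟨T, hT, hTc, hcov⟩ := TopologicalSpace.countable_cover_nhdsWithin (f := U)
    (s := stratum p j) fun x hx =>
      mem_nhdsWithin_of_mem_nhds ((hUV x hx).1.isOpen_U.mem_nhds (hUV x hx).1.mem_U)
  have hTne : T.Nonempty := by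
    obtain ⟨x, hx⟩ := h
    obtain ⟨x', hx', -⟩ := Set.mem_iUnion₂.mp (hcov hx)
    exact ⟨x', hx'⟩
  obtain ⟨x, rfl⟩ := hTc.exists_eq_range hTne
  have hx (s) : x s ∈ stratum p j := hT ⟨s, rfl⟩
  refine ⟨fun s => U (x s), fun s => V (x s), ?_, fun s => (hUV _ (hx s)).1.isOpen_U, fun s _ =>
    ⟨⟨x s, hx s, (hUV _ (hx s)).1⟩, (hUV _ (hx s)).2⟩⟩
  simpa using hcov

theorem IsBranchedCovering.nonempty_regularDecomposition [T2Space Y] [SecondCountableTopology X]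
    (hp : IsBranchedCovering p) : Nonempty (RegularDecomposition p) := by
  choose U V hcov hUo hUV using hp.exists_stratum_decomposition
  -- Removing the earlier `U j r` makes the cover disjoint, and `U j s` then cuts `base j s` out of
  -- its tail.
  let base (j s : ℕ) : Set X := stratum p j ∩ disjointed (U j) s
  have hbU (j s) : base j s ⊆ U j s := Set.inter_subset_right.trans (disjointed_subset _ _)
  refine ⟨{ base := base
            piece := fun j s t => V j s t ∩ p ⁻¹' base j s
            iUnion_base := fun j => ?_
            disjoint_base := fun j r s hrs => ?_
            open_in_tail := fun j s => ⟨U j s, hUo j s, ?_⟩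
            piece_subset := fun j s t => Set.inter_subset_right
            regular := fun j s hne => ?_
            base_subset_image := fun j s t x hx => ?_ }⟩
  · rw [← Set.inter_iUnion, iUnion_disjointed]
    exact Set.inter_eq_left.mpr (hcov j)
  · exact ((disjoint_disjointed (U j)) hrs).mono Set.inter_subset_right Set.inter_subset_right
  · ext x
    refine ⟨fun hx => ⟨hbU j s hx, Set.mem_iUnion₂.mpr ⟨s, le_rfl, hx⟩⟩, ?_⟩
    rintro ⟨hxU, hx⟩
    obtain ⟨r, hr, hxr⟩ := Set.mem_iUnion₂.mp hx
    rcases eq_or_lt_of_le (show s ≤ r from hr) with rfl | hlt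
    · exact hxr
    · have := hxr.2
      rw [disjointed_eq_inter_compl] at this
      exact absurd hxU (Set.mem_iInter₂.mp this.2 s hlt)
  · obtain ⟨⟨x, hx, hreg⟩, -⟩ := hUV j s (hne.mono (hbU j s))
    exact ⟨x, hx, U j s, V j s, hreg, hbU j s, fun t => rfl⟩
  · obtain ⟨y, hy, rfl⟩ := (hUV j s ⟨x, hbU j s hx⟩).2 t (hbU j s hx)
    exact ⟨y, ⟨hy, hx⟩, rfl⟩

namespace RegularDecomposition

variable (D : RegularDecomposition p)

theorem base_subset_stratum (j s : ℕ) : D.base j s ⊆ stratum p j :=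
  (Set.subset_iUnion _ s).trans_eq (D.iUnion_base j)

theorem disjoint_piece (j s : ℕ) : Pairwise fun t t' => Disjoint (D.piece j s t) (D.piece j s t')
    := by
  intro t t' htt'
  rcases (D.base j s).eq_empty_or_nonempty with h | h
  · have h1 := D.piece_subset j s t
    rw [h, Set.preimage_empty, Set.subset_empty_iff] at h1
    simp [h1]
  · obtain ⟨x, -, U, V, hreg, -, hpiece⟩ := D.regular j s h
    rw [hpiece, hpiece]
    exact (hreg.disjoint htt').mono Set.inter_subset_left Set.inter_subset_left

theorem existsUnique_piece (hp : IsBranchedCovering p) (y : Y) :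
    ∃! a : Σ j : ℕ, ℕ × Fin j, y ∈ D.piece a.1 a.2.1 a.2.2 := by
  obtain ⟨j, hj⟩ := ENat.ne_top_iff_exists.mp (hp.finite (p y)).encard_lt_top.ne
  have hy : p y ∈ ⋃ s, D.base j s := by
    rw [D.iUnion_base]; exact hj.symm
  obtain ⟨s, hs⟩ := Set.mem_iUnion.mp hy
  obtain ⟨x, -, U, V, hreg, hU, hpiece⟩ := D.regular j s ⟨_, hs⟩
  have hyV : y ∈ ⋃ t, V t := by
    rw [← hreg.preimage_eq]; exact hU hs
  obtain ⟨t, ht⟩ := Set.mem_iUnion.mp hyV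
  have hyt : y ∈ D.piece j s t := by rw [hpiece]; exact ⟨ht, hs⟩
  refine ⟨⟨j, s, t⟩, hyt, ?_⟩
  rintro ⟨j', s', t'⟩ hy'
  have hy' : y ∈ D.piece j' s' t' := hy'
  have hb : p y ∈ D.base j' s' := D.piece_subset _ _ _ hy'
  have hj' : (p ⁻¹' {p y}).encard = j' := D.base_subset_stratum _ _ hb
  obtain rfl : j = j' := by
    rw [← hj] at hj'; exact_mod_cast hj'
  obtain rfl : s = s' := by
    by_contra hne
    exact Set.disjoint_left.mp (D.disjoint_base j hne) hs hb
  obtain rfl : t = t' := by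
    by_contra hne
    exact Set.disjoint_left.mp (D.disjoint_piece j s hne) hyt hy'
  rfl

theorem pairwise_disjoint_piece (hp : IsBranchedCovering p) :
    Pairwise fun a b : Σ j : ℕ, ℕ × Fin j =>
      Disjoint (D.piece a.1 a.2.1 a.2.2) (D.piece b.1 b.2.1 b.2.2) := fun _ _ hab =>
  Set.disjoint_left.mpr fun y ha hb => hab ((D.existsUnique_piece hp y).unique ha hb)

theorem iUnion_piece (hp : IsBranchedCovering p) :
    ⋃ a : Σ j : ℕ, ℕ × Fin j, D.piece a.1 a.2.1 a.2.2 = Set.univ :=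
  Set.eq_univ_of_forall fun y => Set.mem_iUnion.mpr (D.existsUnique_piece hp y).exists

/-- Pigeonhole: a fibre over the base has `j` points and meets each of the `j` disjoint pieces,
hence each exactly once. -/
theorem injOn_piece (j s : ℕ) (t : Fin j) : Set.InjOn p (D.piece j s t) := by
  have key (x : X) (hx : x ∈ D.base j s) :
      ∃ c : Fin j → Y, (∀ t, c t ∈ D.piece j s t) ∧ Set.range c = p ⁻¹' {x} := by
    choose c hc hcx using fun t => D.base_subset_image j s t hx
    have hinj : Function.Injective c := by
      intro t t' h
      by_contra hne
      exact Set.disjoint_left.mp (D.disjoint_piece j s hne) (hc t) (h ▸ hc t')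
    refine ⟨c, hc, ?_⟩
    have hx' : (p ⁻¹' {x}).encard = j := D.base_subset_stratum j s hx
    refine Set.Finite.eq_of_subset_of_encard_le (Set.finite_range c) ?_ ?_
    · rintro _ ⟨t, rfl⟩
      exact hcx t
    · rw [hx', ← Set.image_univ, hinj.encard_image, Set.encard_univ]
      simp
  intro y hy y' hy' h
  obtain ⟨c, hc, hr⟩ := key (p y) (D.piece_subset _ _ _ hy)
  have h1 (z : Y) (hz : z ∈ D.piece j s t) (hpz : p z = p y) : z = c t := by
    have : z ∈ Set.range c := by rw [hr]; exact hpz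
    obtain ⟨t', rfl⟩ := this
    by_contra hne
    have : t' ≠ t := fun h => hne (h ▸ rfl)
    exact Set.disjoint_left.mp (D.disjoint_piece j s this) (hc t') hz
  rw [h1 y hy rfl, h1 y' hy' h.symm]

theorem M_apply (hp : IsBranchedCovering p) (w : WeightFunction p) (y : Y) :
    D.M w y = ((1 / w.μ y : ℝ) : ℂ) := by
  obtain ⟨a, ha, hu⟩ := D.existsUnique_piece hp y
  rw [RegularDecomposition.M, tsum_eq_single a]
  · rw [RegularDecomposition.m, Set.indicator_of_mem ha]
    change (starRingEnd ℂ) _ * _ = _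
    rw [Complex.conj_ofReal, ← Complex.ofReal_mul, div_mul_div_comm,
      Real.mul_self_sqrt (w.mem_Icc y).1, one_mul]
  · intro b hb
    rw [RegularDecomposition.m, Set.indicator_of_notMem (fun h => hb (hu b h)), mul_zero]

/-- For a bump function `f` at `y` vanishing off `V t`, only one point of each fibre contributes to
`E_μ(f)`. So `μ = (E_μ(f) ∘ p) / f` on the piece near `y`, a quotient of continuous functions. -/
theorem continuousOn_μ [CompactSpace X] [CompactSpace Y] [T2Space Y]
    (hp : IsBranchedCovering p) (w : WeightFunction p) (j s : ℕ) (t : Fin j) :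
    ContinuousOn w.μ (D.piece j s t) := by
  intro y hy
  have hb : p y ∈ D.base j s := D.piece_subset _ _ _ hy
  obtain ⟨x, -, U, V, hreg, hU, hpiece⟩ := D.regular j s ⟨_, hb⟩
  have hyV : y ∈ V t := by
    rw [hpiece] at hy; exact hy.1
  obtain ⟨f, hf1, hf0, hf01⟩ := exists_continuous_one_zero_of_isCompact isCompact_singleton
    (hreg.isOpen_V t).isClosed_compl
    (Set.disjoint_left.mpr fun z (hz : z = y) h => h (hz ▸ hyV) : Disjoint {y} (V t)ᶜ)
  let F : C(Y, ℂ) := ⟨fun y => (f y : ℂ), by fun_prop⟩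
  have hE (z : Y) (hz : z ∈ D.piece j s t) :
      weightedExpectation hp w F (p z) = ((f z * w.μ z : ℝ) : ℂ) := by
    rw [weightedExpectation_apply_sum, Finset.sum_eq_single_of_mem z (by simp)]
    · rw [Complex.ofReal_mul, w.coe_weight]
      rfl
    · intro z' hz' hne
      have hpz : p z' = p z := by simpa using hz'
      have hz'V : z' ∉ V t := fun h => hne <| D.injOn_piece j s t (by
        rw [hpiece]
        refine ⟨h, ?_⟩
        rw [Set.mem_preimage, hpz]
        exact D.piece_subset _ _ _ hz) hz hpz
      have : F z' = 0 := by
        change ((f z' : ℝ) : ℂ) = 0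
        rw [hf0 hz'V]; rfl
      rw [this, zero_mul]
  have hfy : f y = 1 := hf1 rfl
  have hlim : Filter.Tendsto (fun z => (weightedExpectation hp w F (p z)).re / f z)
      (𝓝[D.piece j s t] y) (𝓝 (w.μ y)) := by
    have h1 : ContinuousAt (fun z => (weightedExpectation hp w F (p z)).re / f z) y :=
      ContinuousAt.div (by fun_prop) (by fun_prop) (by rw [hfy]; exact one_ne_zero)
    have h2 := h1.tendsto
    rw [hE y hy, hfy, Complex.ofReal_re, one_mul, div_one] at h2
    exact h2.mono_left nhdsWithin_le_nhds
  refine hlim.congr' ?_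
  have hne : ∀ᶠ z in 𝓝[D.piece j s t] y, f z ≠ 0 :=
    (f.continuous.continuousAt.eventually_ne (by rw [hfy]; exact one_ne_zero)).filter_mono
      nhdsWithin_le_nhds
  filter_upwards [hne, self_mem_nhdsWithin] with z hz hzP
  rw [hE z hzP, Complex.ofReal_re, mul_div_cancel_left₀ _ hz]

theorem continuousOn_M [CompactSpace X] [CompactSpace Y] [T2Space Y]
    (hp : IsBranchedCovering p) (w : WeightFunction p) (j s : ℕ) (t : Fin j) :
    ContinuousOn (D.M w) (D.piece j s t) := by
  obtain ⟨c, hc, hcμ⟩ := w.bounded_below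
  have h : D.M w = fun y => ((1 / w.μ y : ℝ) : ℂ) := funext (D.M_apply hp w)
  rw [h]
  exact Complex.continuous_ofReal.comp_continuousOn
    (continuousOn_const.div (D.continuousOn_μ hp w j s t) fun y _ => (hc.trans_le (hcμ y)).ne')

variable [MeasurableSpace X] [BorelSpace X] [T2Space Y]

/-- The tail is the stratum minus the earlier bases, which are Borel by strong induction, and the
base is relatively open in it. -/
theorem measurableSet_base (hp : IsBranchedCovering p) (j s : ℕ) :
    MeasurableSet (D.base j s) := by
  induction s using Nat.strong_induction_on with
  | _ s ih =>
    obtain ⟨O, hO, hbase⟩ := D.open_in_tail j s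
    have htail : ⋃ r ≥ s, D.base j r = stratum p j \ ⋃ r < s, D.base j r := by
      rw [← D.iUnion_base]
      ext x
      simp only [Set.mem_iUnion, Set.mem_sdiff, not_exists]
      constructor
      · rintro ⟨r, hr, hx⟩
        refine ⟨⟨r, hx⟩, fun r' hr' hx' => ?_⟩
        exact Set.disjoint_left.mp (D.disjoint_base j (hr'.trans_le hr).ne) hx' hx
      · rintro ⟨⟨r, hx⟩, h⟩
        exact ⟨r, le_of_not_gt fun hlt => h r hlt hx, hx⟩
    rw [hbase, htail]
    exact hO.measurableSet.inter ((hp.measurableSet_stratum j).diff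
      (MeasurableSet.iUnion fun r => MeasurableSet.iUnion fun hr => ih r hr))

variable [MeasurableSpace Y] [BorelSpace Y]

theorem measurableSet_piece (hp : IsBranchedCovering p) (j s : ℕ) (t : Fin j) :
    MeasurableSet (D.piece j s t) := by
  rcases (D.base j s).eq_empty_or_nonempty with h | h
  · have h1 := D.piece_subset j s t
    rw [h, Set.preimage_empty, Set.subset_empty_iff] at h1
    rw [h1]
    exact MeasurableSet.empty
  · obtain ⟨x, -, U, V, hreg, -, hpiece⟩ := D.regular j s h
    rw [hpiece]
    exact (hreg.isOpen_V t).measurableSet.inter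
      (p.continuous.measurable (D.measurableSet_base hp j s))

theorem measurable_μ (D : RegularDecomposition p) [CompactSpace X] [CompactSpace Y]
    (hp : IsBranchedCovering p)
    (w : WeightFunction p) : Measurable w.μ := by
  intro A hA
  have h : w.μ ⁻¹' A = ⋃ a : Σ j : ℕ, ℕ × Fin j,
      (D.piece a.1 a.2.1 a.2.2 ∩ w.μ ⁻¹' A) := by
    rw [← Set.iUnion_inter]
    refine (Set.inter_eq_right.mpr fun y _ => ?_).symm
    obtain ⟨a, ha, -⟩ := D.existsUnique_piece hp y
    exact Set.mem_iUnion.mpr ⟨a, ha⟩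
  rw [h]
  refine MeasurableSet.iUnion fun a => ?_
  have hP := D.measurableSet_piece hp a.1 a.2.1 a.2.2
  have hm := (D.continuousOn_μ hp w a.1 a.2.1 a.2.2).domRestrict.measurable
  have := hP.subtype_image (hm hA)
  rwa [Set.domRestrict_eq, Set.preimage_comp, Subtype.image_preimage_coe] at this

theorem measurable_weight (D : RegularDecomposition p) [CompactSpace X] [CompactSpace Y]
    (hp : IsBranchedCovering p)
    (w : WeightFunction p) : Measurable w.weight :=
  (D.measurable_μ hp w).subtype_mk

end RegularDecomposition

end Decomposition

/-! ### Conditional expectation -/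

section Expectation

theorem ContinuousMap.exists_eq_star_mul_self {Z : Type*} [TopologicalSpace Z] (f : C(Z, ℂ))
    (hf : ∀ z, ∃ r : ℝ, 0 ≤ r ∧ f z = r) : ∃ c : C(Z, ℂ), f = star c * c := by
  refine ⟨⟨fun z => ((√(f z).re : ℝ) : ℂ), by fun_prop⟩, ?_⟩
  ext z
  obtain ⟨r, hr, h⟩ := hf z
  change f z = (starRingEnd ℂ) ((√(f z).re : ℝ) : ℂ) * ((√(f z).re : ℝ) : ℂ)
  rw [Complex.conj_ofReal, ← Complex.ofReal_mul, h, Complex.ofReal_re, Real.mul_self_sqrt hr]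

variable {X Y : Type*} [TopologicalSpace X] [CompactSpace X] [TopologicalSpace Y] [CompactSpace Y]
  {p : C(Y, X)} (hp : IsBranchedCovering p) (w : WeightFunction p)

theorem weightedExpectation_star_mul_self (b : C(Y, ℂ)) (x : X) :
    weightedExpectation hp w (star b * b) x =
      ((∑ y ∈ (hp.finite x).toFinset, ‖b y‖ ^ 2 * w.μ y : ℝ) : ℂ) := by
  rw [weightedExpectation_apply_sum]
  push_cast
  refine Finset.sum_congr rfl fun y _ => ?_
  rw [w.coe_weight]
  congr 1
  exact Complex.conj_mul' (b y)

theorem isConditionalExpectation_weightedExpectation :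
    IsConditionalExpectation (ContinuousMap.compStarAlgHom' ℂ ℂ p)
      (weightedExpectation hp w) where
  injective f g h := by
    ext x
    obtain ⟨y, rfl⟩ := hp.surjective x
    exact DFunLike.congr_fun h y
  norm_le b := by
    have h := (weightedExpectation hp w).le_of_opNorm_le
      (LinearMap.mkContinuous_norm_le _ zero_le_one _) b
    rwa [one_mul] at h
  retract a := by
    ext x
    rw [weightedExpectation_apply_sum]
    have h1 := congrArg (fun r : NNReal => ((r : ℝ) : ℂ)) (sum_weight hp w x)
    push_cast at h1
    rw [← mul_one (a x), ← h1, Finset.mul_sum]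
    refine Finset.sum_congr rfl fun y hy => ?_
    rw [← show p y = x by simpa using hy]
    rfl
  left_mul a b := by
    ext x
    rw [weightedExpectation_apply_sum, ContinuousMap.mul_apply, weightedExpectation_apply_sum,
      Finset.mul_sum]
    refine Finset.sum_congr rfl fun y hy => ?_
    rw [← show p y = x by simpa using hy, ← mul_assoc]
    rfl
  right_mul a b := by
    ext x
    rw [weightedExpectation_apply_sum, ContinuousMap.mul_apply, weightedExpectation_apply_sum,
      Finset.sum_mul]
    refine Finset.sum_congr rfl fun y hy => ?_
    rw [← show p y = x by simpa using hy, mul_right_comm]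
    rfl
  positive b := ContinuousMap.exists_eq_star_mul_self _ fun x =>
    ⟨_, Finset.sum_nonneg fun y _ => mul_nonneg (sq_nonneg _) (w.mem_Icc y).1,
      weightedExpectation_star_mul_self hp w b x⟩

theorem isTopologicallyIndexFinite_weightedExpectation :
    IsTopologicallyIndexFinite (ContinuousMap.compStarAlgHom' ℂ ℂ p)
      (weightedExpectation hp w) := by
  obtain ⟨c, hc, hcμ⟩ := w.bounded_below
  -- Keeping only the term of `y` in the fibre sum and using `μ ≥ c` shows that `c⁻¹` suffices; the
  -- maximum ensures `K ≥ 1`.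
  refine ⟨max 1 c⁻¹, le_max_left _ _, fun b => ContinuousMap.exists_eq_star_mul_self _ fun y => ?_⟩
  refine ⟨max 1 c⁻¹ * ∑ z ∈ (hp.finite (p y)).toFinset, ‖b z‖ ^ 2 * w.μ z - ‖b y‖ ^ 2, ?_, ?_⟩
  · have h1 : ‖b y‖ ^ 2 * w.μ y ≤ ∑ z ∈ (hp.finite (p y)).toFinset, ‖b z‖ ^ 2 * w.μ z :=
      Finset.single_le_sum (f := fun z => ‖b z‖ ^ 2 * w.μ z)
        (fun z _ => mul_nonneg (sq_nonneg _) (w.mem_Icc z).1) (by simp)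
    have h2 : ‖b y‖ ^ 2 * c ≤ ‖b y‖ ^ 2 * w.μ y :=
      mul_le_mul_of_nonneg_left (hcμ y) (sq_nonneg _)
    have h3 : c⁻¹ * (‖b y‖ ^ 2 * c) = ‖b y‖ ^ 2 := by field_simp
    have h4 := mul_le_mul_of_nonneg_left (h2.trans h1) (inv_nonneg.mpr hc.le)
    have h5 := mul_le_mul_of_nonneg_right (le_max_right 1 c⁻¹)
      (Finset.sum_nonneg fun z (_ : z ∈ (hp.finite (p y)).toFinset) =>
        mul_nonneg (sq_nonneg ‖b z‖) (w.mem_Icc z).1)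
    linarith
  · change ((max 1 c⁻¹ : ℝ) : ℂ) * weightedExpectation hp w (star b * b) (p y) -
      (starRingEnd ℂ) (b y) * b y = _
    rw [weightedExpectation_star_mul_self, Complex.conj_mul']
    push_cast
    rfl

end Expectation

/-! ### The index element -/

section Index

open scoped NNReal ENNReal

/-- Tonelli for double series, carried out in `ℝ≥0∞` where summability is automatic. -/
theorem NNReal.hasSum_of_hasSum_hasSum {α β : Type*} {t : α → β → ℝ≥0} {T : α → ℝ≥0}
    {m : β → ℝ≥0} {M : ℝ≥0} (hT : ∀ x, HasSum (t x) (T x)) (hm : ∀ a, HasSum (fun x => t x a) (m a))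
    (hM : HasSum m M) : HasSum T M := by
  rw [← ENNReal.hasSum_coe]
  have h : ∑' x, (T x : ℝ≥0∞) = M := by
    calc ∑' x, (T x : ℝ≥0∞) = ∑' x, ∑' a, (t x a : ℝ≥0∞) :=
          tsum_congr fun x => (ENNReal.hasSum_coe.mpr (hT x)).tsum_eq.symm
      _ = ∑' a, ∑' x, (t x a : ℝ≥0∞) := ENNReal.tsum_comm
      _ = ∑' a, (m a : ℝ≥0∞) := tsum_congr fun a => (ENNReal.hasSum_coe.mpr (hm a)).tsum_eq
      _ = M := (ENNReal.hasSum_coe.mpr hM).tsum_eq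
  rw [← h]
  exact ENNReal.summable.hasSum

theorem indicator_one_le {Z : Type*} (P : Set Z) (z : Z) :
    P.indicator (fun _ => (1 : ℝ≥0)) z ≤ 1 :=
  Set.indicator_le_self' (fun _ _ => zero_le) z

/-! ### Countable decompositions and convergence tested on measures -/

section General

variable {Z : Type*} [TopologicalSpace Z] [CompactSpace Z] [MeasurableSpace Z] [BorelSpace Z]

theorem norm_integralFunctional_le (ν : Measure Z) [IsFiniteMeasure ν] :
    ‖integralFunctional ν‖ ≤ ν.real Set.univ :=
  LinearMap.mkContinuous_norm_le _ measureReal_nonneg _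

/-- A countable Borel partition decomposes the functional of a measure, in norm. -/
theorem hasSum_integralFunctional_restrict {ι : Type*} [Countable ι] {P : ι → Set Z}
    (hP : ∀ a, MeasurableSet (P a)) (hd : Pairwise fun a b => Disjoint (P a) (P b))
    (hu : ⋃ a, P a = Set.univ) (ν : Measure Z) [IsFiniteMeasure ν] :
    HasSum (fun a => integralFunctional (ν.restrict (P a))) (integralFunctional ν) := by
  have hpt {E : Type _} [NormedAddCommGroup E] [NormedSpace ℝ E] (f : C(Z, E)) :
      HasSum (fun a => ∫ z in P a, f z ∂ν) (∫ z, f z ∂ν) := by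
    have h := hasSum_integral_iUnion hP hd (f.integrable_of_isFiniteMeasure ν).integrableOn
    rwa [hu, Measure.restrict_univ] at h
  have hs : Summable fun a => ν.real (P a) := by
    have := (hpt (1 : C(Z, ℝ))).summable
    simpa using this
  -- Norms are bounded by masses, which are summable. Convergence in norm is what allows elements of
  -- the bidual to be applied termwise.
  have hsum : Summable fun a => integralFunctional (ν.restrict (P a)) := by
    refine Summable.of_norm_bounded hs fun a => ?_
    simpa using norm_integralFunctional_le (ν.restrict (P a))
  convert hsum.hasSum using 1
  ext f
  have h := hsum.hasSum.map (ContinuousLinearMap.apply ℂ ℂ f) (ContinuousLinearMap.continuous _)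
  exact (hpt f).unique h

variable [T2Space Z]

theorem hasSum_bidual_of_measure {ι : Type*} {F : ι → Bidual C(Z, ℂ)} {J : Bidual C(Z, ℂ)}
    (h : ∀ (ν : Measure Z) [IsFiniteMeasure ν],
      HasSum (fun a => F a (integralFunctional ν)) (J (integralFunctional ν)))
    (φ : StrongDual ℂ C(Z, ℂ)) : HasSum (fun a => F a φ) (J φ) := by
  have hφ : φ ∈ Submodule.span ℂ
      (Set.range fun ν : FiniteMeasure Z => integralFunctional (ν : Measure Z)) := by
    rw [span_integralFunctional]; trivial
  induction hφ using Submodule.span_induction with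
  | mem φ hφ => obtain ⟨ν, rfl⟩ := hφ; exact h ν
  | zero => simp
  | add φ ψ _ _ h₁ h₂ => simpa using h₁.add h₂
  | smul c φ _ h => simpa using h.mul_left c

variable [SecondCountableTopology Z]

theorem borelElement_zero : borelElement (fun _ : Z => (0 : ℝ≥0)) = 0 := by
  refine Bidual.ext_measure fun ν _ => ?_
  rw [borelElement_apply (C := 0) measurable_const fun _ => le_rfl]
  simp

theorem borelElement_indicator_act {P : Set Z} (hP : MeasurableSet P) (ν : Measure Z)
    [IsFiniteMeasure ν] :
    (borelElement (P.indicator fun _ => (1 : ℝ≥0))).act (integralFunctional ν) =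
      integralFunctional (ν.restrict P) := by
  have := isFiniteMeasure_withDensity_coe (indicator_one_le P) ν
  rw [borelElement_act (measurable_const.indicator hP) (indicator_one_le P)]
  congr 1
  rw [← withDensity_indicator_one hP]
  congr 1
  ext z
  by_cases hz : z ∈ P <;> simp [hz]

theorem borelElement_apply_lintegral {r : Z → ℝ≥0} {C : ℝ≥0} (hr : Measurable r)
    (hC : ∀ z, r z ≤ C) (ν : Measure Z) [IsFiniteMeasure ν] :
    borelElement r (integralFunctional ν) = (((∫⁻ z, r z ∂ν).toReal : ℝ) : ℂ) := by
  rw [borelElement_apply hr hC, integral_eq_lintegral_of_nonneg_ae (f := fun z => (r z : ℝ))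
    (Filter.Eventually.of_forall fun z => (r z).2) (by fun_prop)]
  simp

end General

end Index

/-! ### The index sum of an arbitrary basis, and a concrete basis -/

section IndexElement

open scoped NNReal ENNReal

theorem RegularDecomposition.exists_basisFunction_le {X Y : Type*} [TopologicalSpace X]
    [TopologicalSpace Y] {p : C(Y, X)} (D : RegularDecomposition p) (w : WeightFunction p)
    (a : Σ j : ℕ, ℕ × Fin j) : ∃ C : ℝ≥0, ∀ y,
    (D.piece a.1 a.2.1 a.2.2).indicator (fun y => NNReal.sqrt (w.weight y)⁻¹) y ≤ C := by
  obtain ⟨C, hC⟩ := w.exists_inv_weight_le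
  exact ⟨NNReal.sqrt C, fun y => (Set.indicator_le_self' (fun _ _ => zero_le) y).trans
    (NNReal.sqrt_le_sqrt.mpr (hC y))⟩

theorem RegularDecomposition.hasSum_integralFunctional_piece {X Y : Type*} [TopologicalSpace X]
    [MeasurableSpace X] [BorelSpace X] [TopologicalSpace Y] [CompactSpace Y] [T2Space Y]
    [MeasurableSpace Y] [BorelSpace Y] {p : C(Y, X)} (D : RegularDecomposition p)
    (hp : IsBranchedCovering p) (ν : Measure Y)
    [IsFiniteMeasure ν] :
    HasSum (fun a : Σ j : ℕ, ℕ × Fin j =>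
      integralFunctional (ν.restrict (D.piece a.1 a.2.1 a.2.2))) (integralFunctional ν) :=
  hasSum_integralFunctional_restrict (fun _ => D.measurableSet_piece hp _ _ _)
    (D.pairwise_disjoint_piece hp) (D.iUnion_piece hp) ν

theorem hasSum_ofReal_coe {ι : Type*} {f : ι → ℝ≥0} {r : ℝ≥0} :
    HasSum (fun i => ((f i : ℝ) : ℂ)) ((r : ℝ) : ℂ) ↔ HasSum f r := by
  rw [Complex.hasSum_ofReal, NNReal.hasSum_coe]

theorem RegularDecomposition.measurable_basisFunction {X Y : Type*} [TopologicalSpace X]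
    [MeasurableSpace X] [BorelSpace X] [CompactSpace X] [TopologicalSpace Y] [CompactSpace Y]
    [T2Space Y] [MeasurableSpace Y] [BorelSpace Y] {p : C(Y, X)} (D : RegularDecomposition p)
    (w : WeightFunction p) (a : Σ j : ℕ, ℕ × Fin j) (hp : IsBranchedCovering p) : Measurable
    ((D.piece a.1 a.2.1 a.2.2).indicator fun y => NNReal.sqrt (w.weight y)⁻¹) :=
  (NNReal.continuous_sqrt.measurable.comp (D.measurable_weight hp w).inv).indicator
    (D.measurableSet_piece hp _ _ _)

variable {X Y : Type*} [TopologicalSpace X] [CompactSpace X]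
  [TopologicalSpace Y] [CompactSpace Y] [T2Space Y] [SecondCountableTopology Y]
  [MeasurableSpace Y] [BorelSpace Y] {p : C(Y, X)}

/-- The element `1 / μ` of `C(Y)**`. -/
noncomputable def invWeightElement (w : WeightFunction p) : Bidual C(Y, ℂ) :=
  borelElement fun y => (w.weight y)⁻¹

namespace RegularDecomposition

variable [MeasurableSpace X] [BorelSpace X]
  (D : RegularDecomposition p) (hp : IsBranchedCovering p) (w : WeightFunction p)

/-- The sum of `x* x` over a quasi-orthonormal basis, restricted to a piece of the
decomposition. -/
theorem hasSum_conj_mul_self_piece {S : Set (Bidual C(Y, ℂ))}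
    (hS : IsQuasiOrthonormalBasis (ContinuousMap.compStarAlgHom' ℂ ℂ p)
      (weightedExpectation hp w) S) (ν : Measure Y) [IsFiniteMeasure ν]
    (a : Σ j : ℕ, ℕ × Fin j) :
    HasSum (fun x : S => (x : Bidual C(Y, ℂ)).conj.mul x
        (integralFunctional (ν.restrict (D.piece a.1 a.2.1 a.2.2))))
      (invWeightElement w (integralFunctional (ν.restrict (D.piece a.1 a.2.1 a.2.2)))) := by
  set P := D.piece a.1 a.2.1 a.2.2
  have hP : MeasurableSet P := D.measurableSet_piece hp _ _ _
  have hw := D.measurable_weight hp w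
  obtain ⟨C, hC⟩ := w.exists_inv_weight_le
  let g : Y → ℝ≥0 := P.indicator fun y => (w.weight y)⁻¹
  let e : Y → ℝ≥0 := P.indicator fun _ => 1
  have hg : Measurable g := hw.inv.indicator hP
  have he : Measurable e := measurable_const.indicator hP
  have hgC (y) : g y ≤ C := (Set.indicator_le_self' (fun _ _ => zero_le) y).trans (hC y)
  have he1 (y) : e y ≤ 1 := indicator_one_le P y
  have hg0 (y) (hy : y ∉ P) : g y = 0 := Set.indicator_of_notMem hy _
  have he0 (y) (hy : y ∉ P) : e y = 0 := Set.indicator_of_notMem hy _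
  have hgwe : (fun y => g y * w.weight y * e y) = e := by
    ext y
    by_cases hy : y ∈ P
    · simp [g, e, hy, w.weight_ne_zero y]
    · simp [g, e, hy]
  have hweg : (fun y => (w.weight y)⁻¹ * e y) = fun y => e y * g y := by
    ext y
    by_cases hy : y ∈ P <;> simp [g, e, hy]
  -- Expand `e = 1_P` and multiply by `g = 1_P/μ`. Since `g μ e = e`, each term `x i**(⟨x, e⟩) g`
  -- becomes `x x* e`, while the sum becomes `e g = (1/μ) e`.
  have key := hS.expansion (borelElement e) ((borelElement g).act (integralFunctional ν))
  rw [← Bidual.mul_apply, borelElement_mul he he1 hg hgC, ← hweg,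
    ← borelElement_mul (r := fun y => (w.weight y)⁻¹) hw.inv hC he he1, Bidual.mul_apply,
    borelElement_indicator_act hP] at key
  refine key.congr_fun fun x => ?_
  rw [← Bidual.mul_apply, bidualInner, Bidual.mul_assoc,
    biadjoint_mul_borelElement hp w hw (D.injOn_piece _ _ _) hg he hgC he1 hg0 he0, hgwe,
    ← Bidual.mul_assoc, Bidual.mul_comm (x : Bidual C(Y, ℂ)).conj,
    Bidual.mul_apply _ (borelElement e), borelElement_indicator_act hP]

/-- The identity is known on each restriction of `ν` to a piece. Positivity of `x* x` and of `1/μ`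
permits the exchange of the sums over pieces and over `S`. -/
theorem hasSum_conj_mul_self (D : RegularDecomposition p) {S : Set (Bidual C(Y, ℂ))}
    (hS : IsQuasiOrthonormalBasis (ContinuousMap.compStarAlgHom' ℂ ℂ p)
      (weightedExpectation hp w) S) (φ : StrongDual ℂ C(Y, ℂ)) :
    HasSum (fun x : S => (x : Bidual C(Y, ℂ)).conj.mul x φ) (invWeightElement w φ) := by
  refine hasSum_bidual_of_measure (F := fun x : S => (x : Bidual C(Y, ℂ)).conj.mul x) ?_ φ
  intro ν _
  have hJ (ν : Measure Y) [IsFiniteMeasure ν] :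
      ∃ m : ℝ≥0, invWeightElement w (integralFunctional ν) = ((m : ℝ) : ℂ) := by
    obtain ⟨C, hC⟩ := w.exists_inv_weight_le
    have h := borelElement_apply_lintegral (D.measurable_weight hp w).inv hC ν
    exact ⟨_, h⟩
  have hpos (F : Bidual C(Y, ℂ)) (ν : Measure Y) [IsFiniteMeasure ν] := F.exists_conj_mul_self ν
  choose t ht using fun (x : S) (a : Σ j : ℕ, ℕ × Fin j) =>
    hpos x (ν.restrict (D.piece a.1 a.2.1 a.2.2))
  choose T hT using fun x : S => hpos x ν
  choose m hm using fun a : Σ j : ℕ, ℕ × Fin j => hJ (ν.restrict (D.piece a.1 a.2.1 a.2.2))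
  obtain ⟨M, hM⟩ := hJ ν
  simp only [hT, hM]
  rw [hasSum_ofReal_coe]
  have hsum := D.hasSum_integralFunctional_piece hp ν
  refine NNReal.hasSum_of_hasSum_hasSum (t := t) (m := m) (fun x => ?_) (fun a => ?_) ?_
  · have h := hsum.mapL ((x : Bidual C(Y, ℂ)).conj.mul x)
    simp only [ht, hT] at h
    exact hasSum_ofReal_coe.mp h
  · have h := D.hasSum_conj_mul_self_piece hp w hS ν a
    simp only [ht, hm] at h
    exact hasSum_ofReal_coe.mp h
  · have h := hsum.mapL (invWeightElement w)
    simp only [hm, hM] at h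
    exact hasSum_ofReal_coe.mp h

/-- The element `1 / √μ` on a piece of the decomposition. -/
noncomputable def basisElement (a : Σ j : ℕ, ℕ × Fin j) : Bidual C(Y, ℂ) :=
  borelElement ((D.piece a.1 a.2.1 a.2.2).indicator fun y => NNReal.sqrt (w.weight y)⁻¹)

/-! ### The functions `1/√μ` on the pieces as a basis -/

section Basis

variable (a : Σ j : ℕ, ℕ × Fin j)

theorem conj_basisElement (hp : IsBranchedCovering p) :
    (D.basisElement w a).conj = D.basisElement w a :=
  have ⟨_, hC⟩ := D.exists_basisFunction_le w a
  borelElement_conj (D.measurable_basisFunction w a hp) hC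

theorem basisElement_mul_of_ne (hp : IsBranchedCovering p) {a b : Σ j : ℕ, ℕ × Fin j}
    (hab : a ≠ b) : (D.basisElement w a).mul (D.basisElement w b) = 0 := by
  obtain ⟨C, hC⟩ := D.exists_basisFunction_le w a
  obtain ⟨C', hC'⟩ := D.exists_basisFunction_le w b
  rw [basisElement, basisElement, borelElement_mul (D.measurable_basisFunction w a hp) hC
    (D.measurable_basisFunction w b hp) hC', ← borelElement_zero]
  congr 1
  ext y
  by_cases hy : y ∈ D.piece a.1 a.2.1 a.2.2
  · have : y ∉ D.piece b.1 b.2.1 b.2.2 := Set.disjoint_left.mp (D.pairwise_disjoint_piece hp hab) hy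
    simp [this]
  · simp [hy]

theorem basisElement_mul_self (hp : IsBranchedCovering p) :
    (D.basisElement w a).mul (D.basisElement w a) =
      borelElement ((D.piece a.1 a.2.1 a.2.2).indicator fun y => (w.weight y)⁻¹) := by
  obtain ⟨C, hC⟩ := D.exists_basisFunction_le w a
  rw [basisElement, borelElement_mul (D.measurable_basisFunction w a hp) hC
    (D.measurable_basisFunction w a hp) hC]
  congr 1
  ext y
  by_cases hy : y ∈ D.piece a.1 a.2.1 a.2.2
  · simp [hy]
  · simp [hy]

/-- The factors `1/√μ`, `μ`, `1/√μ` cancel on the piece, leaving its indicator. The basis expansion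
is thus the partition of `ν` into pieces. -/
theorem basisElement_mul_inner (c : Bidual C(Y, ℂ)) (ν : Measure Y) [IsFiniteMeasure ν] :
    (D.basisElement w a).mul (biadjoint (starHomCLM (ContinuousMap.compStarAlgHom' ℂ ℂ p))
        (bidualInner (weightedExpectation hp w) (D.basisElement w a) c)) (integralFunctional ν) =
      c (integralFunctional (ν.restrict (D.piece a.1 a.2.1 a.2.2))) := by
  obtain ⟨C, hC⟩ := D.exists_basisFunction_le w a
  have hm := D.measurable_basisFunction w a hp
  have h0 (y) (hy : y ∉ D.piece a.1 a.2.1 a.2.2) : (D.piece a.1 a.2.1 a.2.2).indicator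
      (fun y => NNReal.sqrt (w.weight y)⁻¹) y = 0 := Set.indicator_of_notMem hy _
  rw [bidualInner, D.conj_basisElement w a hp, Bidual.mul_comm (D.basisElement w a) c,
    Bidual.mul_comm (D.basisElement w a), basisElement,
    biadjoint_mul_borelElement hp w (D.measurable_weight hp w) (D.injOn_piece _ _ _) hm hm hC hC
      h0 h0, Bidual.mul_apply, ← borelElement_indicator_act (D.measurableSet_piece hp _ _ _)]
  congr 4
  ext y
  by_cases hy : y ∈ D.piece a.1 a.2.1 a.2.2
  · have h := w.weight_ne_zero y
    simp only [hy, Set.indicator_of_mem]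
    rw [mul_right_comm, NNReal.mul_self_sqrt, inv_mul_cancel₀ h]
  · simp [hy]

/-- If they were equal, orthogonality would make the square vanish, but its value at the Dirac
measure of a point `y` of the piece is `1/μ(y)`. A basis being a set, this injectivity is needed to
sum over indices; empty pieces all give `0` and are left out. -/
theorem basisElement_ne (hp : IsBranchedCovering p) {a b : Σ j : ℕ, ℕ × Fin j}
    (ha : (D.piece a.1 a.2.1 a.2.2).Nonempty) (hab : a ≠ b) :
    D.basisElement w a ≠ D.basisElement w b := by
  intro h
  obtain ⟨y, hy⟩ := ha
  obtain ⟨C, hC⟩ := w.exists_inv_weight_le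
  have h1 := D.basisElement_mul_of_ne w hp hab
  rw [← h, D.basisElement_mul_self w a hp] at h1
  have h2 := borelElement_apply
    ((D.measurable_weight hp w).inv.indicator (D.measurableSet_piece hp a.1 a.2.1 a.2.2))
    (fun y => (Set.indicator_le_self' (fun _ _ => zero_le) y).trans (hC y)) (Measure.dirac y)
  rw [integral_dirac, Set.indicator_of_mem hy] at h2
  exact inv_ne_zero (w.weight_ne_zero y) (NNReal.coe_eq_zero.mp (Complex.ofReal_eq_zero.mp
    (h2.symm.trans (DFunLike.congr_fun h1 (integralFunctional (Measure.dirac y))))))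

variable [T2Space X] [SecondCountableTopology X]

/-- A fibre over the base has exactly one point `y` in the piece and contributes `μ(y) · 1/μ(y) =
1`. That it has one at all is `base_subset_image`. -/
theorem inner_basisElement_self :
    bidualInner (weightedExpectation hp w) (D.basisElement w a) (D.basisElement w a) =
      borelElement ((D.base a.1 a.2.1).indicator fun _ => (1 : ℝ≥0)) := by
  obtain ⟨C, hC⟩ := w.exists_inv_weight_le
  have hP := D.measurableSet_piece hp a.1 a.2.1 a.2.2
  have hgm : Measurable ((D.piece a.1 a.2.1 a.2.2).indicator fun y => (w.weight y)⁻¹) :=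
    (D.measurable_weight hp w).inv.indicator hP
  refine Bidual.ext_measure fun ν _ => ?_
  have := isFiniteMeasure_bind_fibreMeasure hp w ν
  rw [bidualInner, D.conj_basisElement w a hp, D.basisElement_mul_self w a hp, biadjoint_apply,
    integralFunctional_comp_weightedExpectation,
    borelElement_apply_lintegral hgm
      (fun y => (Set.indicator_le_self' (fun _ _ => zero_le) y).trans (hC y)),
    borelElement_apply_lintegral (measurable_const.indicator (D.measurableSet_base hp _ _))
      (indicator_one_le _),
    Measure.lintegral_bind (measurable_fibreMeasure hp w).aemeasurable
      hgm.coe_nnreal_ennreal.aemeasurable]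
  congr 2
  refine lintegral_congr fun x => ?_
  rw [lintegral_fibreMeasure hp w hgm.coe_nnreal_ennreal]
  by_cases hx : x ∈ D.base a.1 a.2.1
  · obtain ⟨y, hy, rfl⟩ := D.base_subset_image a.1 a.2.1 a.2.2 hx
    rw [Finset.sum_eq_single_of_mem y (by simp)]
    · rw [Set.indicator_of_mem hx, Set.indicator_of_mem hy, ← ENNReal.coe_mul,
        mul_inv_cancel₀ (w.weight_ne_zero y)]
    · intro z hz hne
      have : z ∉ D.piece a.1 a.2.1 a.2.2 := fun h =>
        hne (D.injOn_piece _ _ _ h hy (by simpa using hz))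
      rw [Set.indicator_of_notMem this, ENNReal.coe_zero, mul_zero]
  · rw [Set.indicator_of_notMem hx, ENNReal.coe_zero]
    refine Finset.sum_eq_zero fun z hz => ?_
    have hzx : p z = x := by simpa using hz
    have : z ∉ D.piece a.1 a.2.1 a.2.2 := fun h =>
      hx (hzx ▸ D.piece_subset _ _ _ h)
    rw [Set.indicator_of_notMem this, ENNReal.coe_zero, mul_zero]

end Basis

theorem isQuasiOrthonormalBasis_range [T2Space X] [SecondCountableTopology X] :
    IsQuasiOrthonormalBasis (ContinuousMap.compStarAlgHom' ℂ ℂ p) (weightedExpectation hp w)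
      (Set.range fun a : {a : Σ j : ℕ, ℕ × Fin j // (D.piece a.1 a.2.1 a.2.2).Nonempty} =>
        D.basisElement w a) where
  orthogonal := by
    rintro _ ⟨a, rfl⟩ _ ⟨b, rfl⟩ hne
    have hab : a.1 ≠ b.1 := fun h => hne (by simp only [h])
    rw [bidualInner, D.conj_basisElement w _ hp, D.basisElement_mul_of_ne w hp hab, map_zero]
  idempotent := by
    rintro _ ⟨a, rfl⟩
    have hm : Measurable ((D.base a.1.1 a.1.2.1).indicator fun _ => (1 : ℝ≥0)) :=
      measurable_const.indicator (D.measurableSet_base hp _ _)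
    rw [D.inner_basisElement_self hp w, borelElement_mul hm (indicator_one_le _) hm
      (indicator_one_le _)]
    congr 1
    ext x
    by_cases hx : x ∈ D.base a.1.1 a.1.2.1 <;> simp [hx]
  selfAdjoint := by
    rintro _ ⟨a, rfl⟩
    rw [D.inner_basisElement_self hp w]
    exact borelElement_conj (measurable_const.indicator (D.measurableSet_base hp _ _))
      (indicator_one_le _)
  expansion c := by
    refine hasSum_bidual_of_measure fun ν _ => ?_
    have hinj : Function.Injective
        fun a : {a : Σ j : ℕ, ℕ × Fin j // (D.piece a.1 a.2.1 a.2.2).Nonempty} =>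
          D.basisElement w a := by
      intro a b h
      by_contra hne
      exact D.basisElement_ne w hp a.2 (fun h => hne (Subtype.ext h)) h
    rw [← (Equiv.ofInjective _ hinj).hasSum_iff]
    have h := (D.hasSum_integralFunctional_piece hp ν).mapL c
    -- The partition sum runs over all indices; those of empty pieces contribute zero and can be
    -- dropped.
    rw [← hasSum_subtype_iff_of_support_subset
      (s := {a | (D.piece a.1 a.2.1 a.2.2).Nonempty})] at h
    · exact h.congr_fun fun a => D.basisElement_mul_inner hp w a c ν
    · intro a ha
      by_contra hne
      refine ha ?_
      rw [Set.mem_ofPred_eq, Set.not_nonempty_iff_eq_empty] at hne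
      have : integralFunctional (ν.restrict (D.piece a.1 a.2.1 a.2.2)) = 0 := by
        ext f
        simp [integralFunctional_apply, hne]
      change c (integralFunctional (ν.restrict (D.piece a.1 a.2.1 a.2.2))) = 0
      rw [this, map_zero]

theorem isIndexElement_invWeightElement (D : RegularDecomposition p) [T2Space X]
    [SecondCountableTopology X] :
    IsIndexElement (ContinuousMap.compStarAlgHom' ℂ ℂ p) (weightedExpectation hp w)
      (invWeightElement w) :=
  ⟨⟨_, D.isQuasiOrthonormalBasis_range hp w⟩, fun _ hS => D.hasSum_conj_mul_self hp w hS⟩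

theorem isBorelElement_invWeightElement (hp : IsBranchedCovering p) :
    IsBorelElement (D.M w) (invWeightElement w) := by
  obtain ⟨C, hC⟩ := w.exists_inv_weight_le
  have hw := D.measurable_weight hp w
  have hM (y : Y) : D.M w y = ((((w.weight y)⁻¹ : ℝ≥0) : ℝ) : ℂ) := by
    rw [D.M_apply hp w, one_div]; rfl
  refine ⟨?_, ⟨C, fun y => ?_⟩, fun ν _ => ?_⟩
  · rw [funext hM]
    fun_prop
  · rw [hM, Complex.norm_real, NNReal.norm_eq]
    exact hC y
  · simp only [hM]
    rw [integral_complex_ofReal]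
    exact borelElement_apply hw.inv hC ν

end RegularDecomposition

end IndexElement

theorem IsBorelElement.unique {Y : Type*} [TopologicalSpace Y] [CompactSpace Y] [T2Space Y]
    [MeasurableSpace Y] [BorelSpace Y] {g : Y → ℂ} {F G : Bidual C(Y, ℂ)}
    (hF : IsBorelElement g F) (hG : IsBorelElement g G) : F = G :=
  Bidual.ext_measure fun ν _ => (hF.2.2 ν).trans (hG.2.2 ν).symm

theorem IsIndexElement.unique {A B : Type*} [CommCStarAlgebra A] [CommCStarAlgebra B]
    {i : A →⋆ₐ[ℂ] B} {E : B →L[ℂ] A} {F G : Bidual B}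
    (hF : IsIndexElement i E F) (hG : IsIndexElement i E G) : F = G := by
  obtain ⟨S, hS⟩ := hF.1
  ext φ
  exact (hF.2 S hS φ).unique (hG.2 S hS φ)

theorem mainTheorem7 {X Y : Type*}
    [TopologicalSpace X] [CompactSpace X] [T2Space X] [SecondCountableTopology X]
    [TopologicalSpace Y] [CompactSpace Y] [T2Space Y] [SecondCountableTopology Y]
    [MeasurableSpace Y] [BorelSpace Y]
    (p : C(Y, X)) (hp : IsBranchedCovering p) (w : WeightFunction p) :
    IsConditionalExpectation (ContinuousMap.compStarAlgHom' ℂ ℂ p) (weightedExpectation hp w) ∧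
    IsTopologicallyIndexFinite (ContinuousMap.compStarAlgHom' ℂ ℂ p)
      (weightedExpectation hp w) ∧
    Nonempty (RegularDecomposition p) ∧
    ∀ D : RegularDecomposition p,
      (∀ y, D.M w y = ((1 / w.μ y : ℝ) : ℂ)) ∧
      (∀ j s t, ContinuousOn (D.M w) (D.piece j s t)) ∧
      ∃ J : Bidual C(Y, ℂ),
        (∀ J', IsBorelElement (D.M w) J' ↔ J' = J) ∧
        (∀ J', IsIndexElement (ContinuousMap.compStarAlgHom' ℂ ℂ p)
          (weightedExpectation hp w) J' ↔ J' = J) := by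
  -- The statement puts no σ-algebra on `X`; the Borel one is needed for the fibre kernel and for
  -- measures on the base.
  let : MeasurableSpace X := borel X
  have : BorelSpace X := ⟨rfl⟩
  refine ⟨isConditionalExpectation_weightedExpectation hp w,
    isTopologicallyIndexFinite_weightedExpectation hp w, hp.nonempty_regularDecomposition,
    fun D => ⟨D.M_apply hp w, D.continuousOn_M hp w, invWeightElement w, fun J' => ?_,
      fun J' => ?_⟩⟩
  · have hJ := D.isBorelElement_invWeightElement w hp
    exact ⟨fun h => h.unique hJ, fun h => h ▸ hJ⟩
  · have hJ := D.isIndexElement_invWeightElement hp w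
    exact ⟨fun h => h.unique hJ, fun h => h ▸ hJ⟩
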